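/- \textbf{Definitions.} Let $\mathbb{B}=\mathbb{F}_2$. A \emph{circuit} $\mathbf{H}$ with input variables $I$ and output variables $O$ (finite sets) is a finite directed acyclic graph whose vertices are labelled by input variables, output variables, or gates $\neg$ (fan-in 1), $\wedge$, $\vee$ (fan-in 2). Each input (output) variable labels exactly one vertex; input vertices have no incoming edges, output vertices have no outgoing edges and one incoming edge, and a gate has as many incoming edges as its fan-in. It computes a function $\mathbb{B}^{|I|}\to\mathbb{B}^{|O|}$ in the usual way. $\mathbf{H}$ is \emph{independent} if it is a composition of single-output sub-circuits, one for each output, any two of which share no vertices other than vertices of input variables. The support of an output $y$ is the set of input variables from which a path leads to $y$; the number $\#_{\rm in}\mathbf{H}$ of \emph{individual inputs} is the sum over all outputs of the sizes of their supports. For integers $k\ge 1$ and $d\ge 0$, call $\mathbf{H}$ with $k$ inputs and $r'$ outputs \emph{feasible for} $(k,d)$ if it is independent and computes $x\mapsto xG$ for a matrix $G\in\mathbb{B}^{k\times r'}$ such that $x\mapsto xG$ is injective and the systematic linear code $\{(x\,\|\,xG) : x\in\mathbb{B}^k\}$ has minimum Hamming distance at least $d$. The number $r'$ is the \emph{parity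 size} of $\mathbf{H}$. An \emph{optimal solution of the OptiCC instance $(k,d)$ with parity size bounded by $r$} is a feasible circuit of parity size at most $r$ that, among all feasible circuits of parity size at most $r$, minimizes first $\#_{\rm in}\mathbf{H}$ and then the parity size. \textbf{Theorem.} There are an algorithm (a program for a unit-cost random access machine whose arithmetic is successor and predecessor) and an absolute constant $C$ such that for all integers $k\ge 1$, $d\ge 0$, $r\ge 1$ the algorithm, on input $(k,d,r)$, halts after at most $C\cdot\frac{r^2}{k}\cdot 2^{rk+2k}$ steps and either outputs (an explicit description of) an optimal solution $\mathbf{H}$ of the OptiCC instance $(k,d)$ with parity size bounded by $r$, or correctly reports that no feasible circuit of parity size at most $r$ exists. In the first case $\mathbf{H}$ has at most $C\cdot\frac{r}{k}\cdot 2^{k}$ gates, and every directed path in $\mathbf{H}$ contains at most $C\cdot k$ gates. -/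

import Mathlib

namespace OptiCC

/-! ### Circuits -/

/-- The logic gates: inverter, logical-and, logical-or. -/
inductive Gate
  | not
  | and
  | or
  deriving DecidableEq

/-- The fan-in of a gate. -/
def Gate.fanIn : Gate → ℕ
  | .not => 1
  | .and => 2
  | .or => 2

/-- The label of a vertex: an input variable, an output variable, or a gate. -/
inductive Label (I O : Type)
  | input (i : I)
  | output (y : O)
  | gate (g : Gate)

/-- A combinational logic circuit with input variables `I`, output variables `O` and vertex set `V`:
a labelled directed acyclic graph. An output vertex has exactly one incoming edge, which carries
the signal that is output there. -/
structure Circuit (I O V : Type) where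
  /-- `edge u v`: there is an edge from `u` to `v`. -/
  edge : V → V → Prop
  /-- The labelling function. -/
  label : V → Label I O
  input_unique : ∀ i : I, ∃! v, label v = .input i
  output_unique : ∀ y : O, ∃! v, label v = .output y
  input_no_incoming : ∀ i v, label v = .input i → ∀ u, ¬ edge u v
  output_no_outgoing : ∀ y v, label v = .output y → ∀ u, ¬ edge v u
  output_incoming : ∀ y v, label v = .output y → {u | edge u v}.ncard = 1
  gate_incoming : ∀ g v, label v = .gate g → {u | edge u v}.ncard = g.fanIn
  acyclic : ∀ v, ¬ Relation.TransGen edge v v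

namespace Circuit

variable {I O V : Type}

theorem edge_wellFounded [Finite V] (H : Circuit I O V) : WellFounded H.edge := by
  have hi : Std.Irrefl (Relation.TransGen H.edge) := ⟨H.acyclic⟩
  have ht : IsTrans V (Relation.TransGen H.edge) := ⟨fun _ _ _ => Relation.TransGen.trans⟩
  have h := Finite.wellFounded_of_trans_of_irrefl (Relation.TransGen H.edge)
  exact Subrelation.wf (fun h => Relation.TransGen.single h) h

open Classical in
/-- The signal leaving the vertex `v` on the input `x`, from the signals `s` of its predecessors. -/
noncomputable def localValue (H : Circuit I O V) (x : I → ZMod 2) (v : V)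
    (s : (u : V) → H.edge u v → ZMod 2) : ZMod 2 :=
  match H.label v with
  | .input i => x i
  | .output _ => if ∃ u, ∃ h : H.edge u v, s u h = 1 then 1 else 0
  | .gate .not => if ∃ u, ∃ h : H.edge u v, s u h = 1 then 0 else 1
  | .gate .and => if ∀ u, ∀ h : H.edge u v, s u h = 1 then 1 else 0
  | .gate .or => if ∃ u, ∃ h : H.edge u v, s u h = 1 then 1 else 0

/-- The signal leaving each vertex on the input `x`. -/
noncomputable def value [Finite V] (H : Circuit I O V) (x : I → ZMod 2) : V → ZMod 2 :=
  H.edge_wellFounded.fix (H.localValue x)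

theorem value_eq [Finite V] (H : Circuit I O V) (x : I → ZMod 2) (v : V) :
    H.value x v = H.localValue x v (fun u _ => H.value x u) :=
  H.edge_wellFounded.fix_eq (H.localValue x) v

/-- The vertex of an input variable. -/
noncomputable def inputVertex (H : Circuit I O V) (i : I) : V := (H.input_unique i).choose

/-- The vertex of an output variable. -/
noncomputable def outputVertex (H : Circuit I O V) (y : O) : V := (H.output_unique y).choose

/-- The Boolean function computed by the circuit. -/
noncomputable def eval [Finite V] (H : Circuit I O V) (x : I → ZMod 2) : O → ZMod 2 :=
  fun y => H.value x (H.outputVertex y)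

/-- `S` is the vertex set of a sub-circuit of `H` that computes the output `y` and no other output:
with every vertex it contains all its incoming edges, so that all the signals in it are
computed inside it. -/
def IsSubcircuitFor (H : Circuit I O V) (y : O) (S : Set V) : Prop :=
  (∀ z, H.outputVertex z ∈ S ↔ z = y) ∧ ∀ u v, H.edge u v → v ∈ S → u ∈ S

/-- The circuit is a composition of single-output sub-circuits, one for each output, any two of
which share no vertices other than those of input variables. -/
def Independent (H : Circuit I O V) : Prop :=
  ∃ S : O → Set V, (∀ y, H.IsSubcircuitFor y (S y)) ∧
    (∀ v, (∃ i, H.label v = .input i) ∨ ∃ y, v ∈ S y) ∧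
    ∀ y z, y ≠ z → ∀ v ∈ S y ∩ S z, ∃ i, H.label v = .input i

/-- The support inputs of the output `y`: those from which a path leads to `y`. -/
def support (H : Circuit I O V) (y : O) : Set I :=
  {i | Relation.ReflTransGen H.edge (H.inputVertex i) (H.outputVertex y)}

/-- The number of individual inputs. -/
noncomputable def individualInputs [Fintype O] (H : Circuit I O V) : ℕ :=
  ∑ y, (H.support y).ncard

/-- The vertices that are gates. -/
def gates (H : Circuit I O V) : Set V := {v | ∃ g, H.label v = .gate g}

open Classical in
/-- The number of gates on a list of vertices. -/
noncomputable def gatesOn (H : Circuit I O V) (p : List V) : ℕ :=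
  p.countP (fun v => decide (v ∈ H.gates))

/-- Every directed path of the circuit contains at most `L` gates. -/
def LongestPathLE (H : Circuit I O V) (L : ℝ) : Prop :=
  ∀ p : List V, p.IsChain H.edge → (H.gatesOn p : ℝ) ≤ L

end Circuit

/-! ### Codes -/

/-- The minimum Hamming distance of a set of words. -/
noncomputable def minDist {n : ℕ} (C : Set (Fin n → ZMod 2)) : ℕ :=
  sInf {e | ∃ x ∈ C, ∃ y ∈ C, x ≠ y ∧ e = hammingDist x y}

/-- The systematic encoder with parity generator matrix `G`. -/
def encode {k m : ℕ} (G : Matrix (Fin k) (Fin m) (ZMod 2)) (x : Fin k → ZMod 2) :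
    Fin (k + m) → ZMod 2 :=
  Fin.append x (Matrix.vecMul x G)

/-- `H` is an independent circuit that implements an injective parity generator matrix of a
systematic linear code of message size `k` with minimum distance at least `d`. -/
def IsFeasible {k m : ℕ} {V : Type} [Finite V] (d : ℕ) (H : Circuit (Fin k) (Fin m) V) : Prop :=
  (∃ G : Matrix (Fin k) (Fin m) (ZMod 2),
    (∀ x, H.eval x = Matrix.vecMul x G) ∧
    Function.Injective (fun x : Fin k → ZMod 2 => Matrix.vecMul x G) ∧
    d ≤ minDist (Set.range (encode G))) ∧
  H.Independent

/-- `H` is an optimal solution of the instance `(k, d)` for parity sizes at most `r`: it is feasible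
and minimizes first the number of individual inputs, then the parity size, among all feasible
circuits of parity size at most `r`. -/
def IsOptimalSolution {k m : ℕ} {V : Type} [Finite V] (d r : ℕ)
    (H : Circuit (Fin k) (Fin m) V) : Prop :=
  m ≤ r ∧ IsFeasible d H ∧
    ∀ (m' : ℕ) (W : Type) [Finite W] (H' : Circuit (Fin k) (Fin m') W),
      m' ≤ r → IsFeasible d H' →
        H.individualInputs < H'.individualInputs ∨
          (H.individualInputs = H'.individualInputs ∧ m ≤ m')

/-! ### Random access machines

Structured programs for a random access machine whose only arithmetic is the successor and the
predecessor. Each instruction and each evaluation of a test takes one step. No number in a run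
of `t` steps exceeds `t` plus the largest input and the largest constant of the program. -/

/-- The state: registers, which a program refers to by fixed indices, and an addressable memory. -/
structure State where
  reg : ℕ → ℕ
  mem : ℕ → ℕ

/-- Instructions. -/
inductive Instr
  /-- `reg a := n` -/
  | const (a n : ℕ)
  /-- `reg a := reg b` -/
  | copy (a b : ℕ)
  /-- `reg a := reg a + 1` -/
  | inc (a : ℕ)
  /-- `reg a := reg a - 1`, where `0 - 1 = 0` -/
  | dec (a : ℕ)
  /-- `reg a := mem (reg b)` -/
  | load (a b : ℕ)
  /-- `mem (reg a) := reg b` -/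
  | store (a b : ℕ)

/-- The effect of an instruction. -/
def Instr.run : Instr → State → State
  | .const a n, s => { s with reg := Function.update s.reg a n }
  | .copy a b, s => { s with reg := Function.update s.reg a (s.reg b) }
  | .inc a, s => { s with reg := Function.update s.reg a (s.reg a + 1) }
  | .dec a, s => { s with reg := Function.update s.reg a (s.reg a - 1) }
  | .load a b, s => { s with reg := Function.update s.reg a (s.mem (s.reg b)) }
  | .store a b, s => { s with mem := Function.update s.mem (s.reg a) (s.reg b) }

/-- Tests: comparisons of two registers. -/
inductive Test
  | eq (a b : ℕ)
  | lt (a b : ℕ)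

/-- The outcome of a test. -/
def Test.holds : Test → State → Prop
  | .eq a b, s => s.reg a = s.reg b
  | .lt a b, s => s.reg a < s.reg b

/-- Structured programs. -/
inductive Program
  | instr (i : Instr)
  | seq (p q : Program)
  | branch (c : Test) (p q : Program)
  | loop (c : Test) (p : Program)

/-- `Exec p s t s'`: started in the state `s`, the program `p` halts after exactly `t` steps in the
state `s'`. -/
inductive Exec : Program → State → ℕ → State → Prop
  | instr (i : Instr) (s : State) : Exec (.instr i) s 1 (i.run s)
  | seq {p q : Program} {s s' s'' : State} {t t' : ℕ} :
      Exec p s t s' → Exec q s' t' s'' → Exec (.seq p q) s (t + t') s''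
  | branch_true {c : Test} {p q : Program} {s s' : State} {t : ℕ} :
      c.holds s → Exec p s t s' → Exec (.branch c p q) s (t + 1) s'
  | branch_false {c : Test} {p q : Program} {s s' : State} {t : ℕ} :
      ¬ c.holds s → Exec q s t s' → Exec (.branch c p q) s (t + 1) s'
  | loop_true {c : Test} {p : Program} {s s' s'' : State} {t t' : ℕ} :
      c.holds s → Exec p s t s' → Exec (.loop c p) s' t' s'' →
        Exec (.loop c p) s (t + t' + 1) s''
  | loop_false {c : Test} {p : Program} {s : State} :
      ¬ c.holds s → Exec (.loop c p) s 1 s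

/-- A program has at most one halting run from each state. -/
theorem Exec.deterministic {p : Program} {s s₁ s₂ : State} {t₁ t₂ : ℕ}
    (h₁ : Exec p s t₁ s₁) (h₂ : Exec p s t₂ s₂) : t₁ = t₂ ∧ s₁ = s₂ := by
  induction h₁ generalizing t₂ s₂ with
  | instr i s => cases h₂; exact ⟨rfl, rfl⟩
  | seq _ _ ih ih' =>
    cases h₂ with
    | seq a b =>
      obtain ⟨rfl, rfl⟩ := ih a
      obtain ⟨rfl, rfl⟩ := ih' b
      exact ⟨rfl, rfl⟩
  | branch_true hc _ ih =>
    cases h₂ with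
    | branch_true _ a => obtain ⟨rfl, rfl⟩ := ih a; exact ⟨rfl, rfl⟩
    | branch_false hn _ => exact absurd hc hn
  | branch_false hc _ ih =>
    cases h₂ with
    | branch_true hn _ => exact absurd hn hc
    | branch_false _ a => obtain ⟨rfl, rfl⟩ := ih a; exact ⟨rfl, rfl⟩
  | loop_true hc _ _ ih ih' =>
    cases h₂ with
    | loop_true _ a b =>
      obtain ⟨rfl, rfl⟩ := ih a
      obtain ⟨rfl, rfl⟩ := ih' b
      exact ⟨rfl, rfl⟩
    | loop_false hn => exact absurd hc hn
  | loop_false hc =>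
    cases h₂ with
    | loop_true hn _ _ => exact absurd hn hc
    | loop_false _ => exact ⟨rfl, rfl⟩

/-- The initial state: the registers 0, 1, 2 hold `k`, `d`, `r`; all else is zero. -/
def initialState (k d r : ℕ) : State where
  reg := fun i => if i = 0 then k else if i = 1 then d else if i = 2 then r else 0
  mem := fun _ => 0

/-- The three memory cells `c 0`, `c 1`, `c 2` describe the vertex `v` of `H`: its label, and the
vertices from which its incoming edges come. -/
def DescribesVertex {k m n : ℕ} (H : Circuit (Fin k) (Fin m) (Fin n)) (v : Fin n)
    (c : ℕ → ℕ) : Prop :=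
  match H.label v with
  | .input i => c 0 = 0 ∧ c 1 = i
  | .output y => c 0 = 1 ∧ c 1 = y ∧ ∀ u : Fin n, H.edge u v ↔ (u : ℕ) = c 2
  | .gate .not => c 0 = 2 ∧ ∀ u : Fin n, H.edge u v ↔ (u : ℕ) = c 1
  | .gate .and => c 0 = 3 ∧ ∀ u : Fin n, H.edge u v ↔ (u : ℕ) = c 1 ∨ (u : ℕ) = c 2
  | .gate .or => c 0 = 4 ∧ ∀ u : Fin n, H.edge u v ↔ (u : ℕ) = c 1 ∨ (u : ℕ) = c 2

/-- The state `s` reports the circuit `H`: register 0 holds 1, register 1 the number of outputs,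
register 2 the number of vertices, and the memory, from the address in register 3 on, the
descriptions of the vertices. -/
def Reports {k m n : ℕ} (s : State) (H : Circuit (Fin k) (Fin m) (Fin n)) : Prop :=
  s.reg 0 = 1 ∧ s.reg 1 = m ∧ s.reg 2 = n ∧
    ∀ v : Fin n, DescribesVertex H v (fun j => s.mem (s.reg 3 + 3 * v + j))

/-- The state `s` reports that there is no circuit: register 0 holds 0. -/
def ReportsNone (s : State) : Prop := s.reg 0 = 0

end OptiCC

namespace OptiCC

/-! ### Reasoning about programs -/

/-! The search runs over matrices, not over circuits, because the optimal cost of a circuit can be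
read off its matrix. If a circuit computes `x ↦ xG` and `G i y ≠ 0`, then a path leads from input
`i` to output `y`, since otherwise changing `x i` could not affect `y` (`Circuit.mem_support`). So
the number of individual inputs is at least the weight of `G`, and the parity size is at least its
number of non-zero columns (`exists_matrix_of_isFeasible`). Conversely, adding up the entries of
each non-zero column by a chain of exclusive ors, separately for each column, gives an independent
circuit that attains both bounds (`Built.isFeasible_circuit`, `Built.individualInputs_circuit_le`).
Parity sizes below `r` are covered by matrices with zero columns, which do not influence any parity
weight (`encodes_submatrix_iff`). It remains to minimize lexicographically the pair of weight and
number of non-zero columns over the suitable `k × r` matrices.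

By linearity, suitability is a condition on each non-zero message: its parity bits do not all
vanish, and its code word has weight at least `d` (`encodes_iff`, `matrixOk_iff`). The machine
enumerates the matrices by a binary counter with `r * k` digits and, for each of them, the messages
by one with `k` digits. One message costs `O(r * k)` steps, and so does writing a circuit when a
better matrix is found. The total is `O(r * k * 2 ^ k * 2 ^ (r * k))`, which is within the claimed
bound because `k * k ≤ r * 2 ^ k` for `k ≤ r`. For `r < k` no linear map into `r` bits is injective,
and the answer is immediate. A chain uses four gates and depth three per entry, so there are `O(r *
k)` gates and paths with at most `3 * k` gates; `k ^ 2 ≤ 2 * 2 ^ k` turns the former into the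
claimed form.

The written circuit is verified through a list of vertices annotated with value, support, owner and
rank. Local consistency of the annotations (`Consistent`) holds for each vertex as it is appended,
and implies the global properties by induction on the position. The program writes only the
descriptions; the annotated list accompanies it in the loop invariants. -/

/-- The program `p`, started in `s`, halts after at most `T` steps in a state satisfying `Q`. -/
def Runs (p : Program) (s : State) (T : ℕ) (Q : State → Prop) : Prop :=
  ∃ t s', Exec p s t s' ∧ t ≤ T ∧ Q s'

/-- Whether an instruction writes the register `i`. -/
def Instr.writes : Instr → ℕ → Bool
  | .const a _, i => i == a
  | .copy a _, i => i == a
  | .inc a, i => i == a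
  | .dec a, i => i == a
  | .load a _, i => i == a
  | .store _ _, _ => false

/-- Whether an instruction writes the memory. -/
def Instr.stores : Instr → Bool
  | .store _ _ => true
  | _ => false

/-- Whether a program contains an instruction that writes the register `i`. -/
def Program.writes : Program → ℕ → Bool
  | .instr c, i => c.writes i
  | .seq p q, i => p.writes i || q.writes i
  | .branch _ p q, i => p.writes i || q.writes i
  | .loop _ p, i => p.writes i

/-- Whether a program contains an instruction that writes the memory. -/
def Program.stores : Program → Bool
  | .instr c => c.stores
  | .seq p q => p.stores || q.stores
  | .branch _ p q => p.stores || q.stores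
  | .loop _ p => p.stores

/-- `writes` is a syntactic, computable check, so for a concrete program and register the hypothesis
is closed by `rfl`. -/
theorem Exec.reg_eq {p : Program} {s s' : State} {t : ℕ} (h : Exec p s t s') {a : ℕ}
    (ha : p.writes a = false) : s'.reg a = s.reg a := by
  induction h with
  | instr i s =>
    cases i <;> simp_all [Program.writes, Instr.writes, Instr.run, Function.update]
  | _ => simp_all [Program.writes]

theorem Exec.mem_eq {p : Program} {s s' : State} {t : ℕ} (h : Exec p s t s')
    (ha : p.stores = false) : s'.mem = s.mem := by
  induction h with
  | instr i s => cases i <;> simp_all [Program.stores, Instr.stores, Instr.run]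
  | _ => simp_all [Program.stores]

theorem Runs.mono {p : Program} {s : State} {T T' : ℕ} {Q Q' : State → Prop} (h : Runs p s T Q)
    (hT : T ≤ T') (hQ : ∀ s', Q s' → Q' s') : Runs p s T' Q' := by
  obtain ⟨t, s', e, ht, hq⟩ := h
  exact ⟨t, s', e, ht.trans hT, hQ _ hq⟩

/-- The frame rule: what a program does not write is unchanged. -/
theorem Runs.conseq {p : Program} {s : State} {T T' : ℕ} {Q Q' : State → Prop} (h : Runs p s T Q)
    (hT : T ≤ T') (hQ : ∀ s', Q s' → (∀ a, p.writes a = false → s'.reg a = s.reg a) →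
      (p.stores = false → s'.mem = s.mem) → Q' s') : Runs p s T' Q' := by
  obtain ⟨t, s', e, ht, hq⟩ := h
  exact ⟨t, s', e, ht.trans hT, hQ _ hq (fun _ => e.reg_eq) e.mem_eq⟩

theorem runs_instr {i : Instr} {s : State} {Q : State → Prop} (h : Q (i.run s)) :
    Runs (.instr i) s 1 Q :=
  ⟨1, _, .instr i s, le_rfl, h⟩

theorem runs_seq {p q : Program} {s : State} {T T' : ℕ} {Q : State → Prop}
    (h : Runs p s T (fun s' => Runs q s' T' Q)) : Runs (.seq p q) s (T + T') Q := by
  obtain ⟨t, s', e, ht, t', s'', e', ht', hq⟩ := h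
  exact ⟨_, s'', .seq e e', by omega, hq⟩

theorem runs_branch {c : Test} {p q : Program} {s : State} {T T' : ℕ} {Q : State → Prop}
    (hp : c.holds s → Runs p s T Q) (hq : ¬ c.holds s → Runs q s T' Q) :
    Runs (.branch c p q) s (max T T' + 1) Q := by
  by_cases hc : c.holds s
  · obtain ⟨t, s', e, ht, h⟩ := hp hc
    exact ⟨_, s', .branch_true hc e, by omega, h⟩
  · obtain ⟨t, s', e, ht, h⟩ := hq hc
    exact ⟨_, s', .branch_false hc e, by omega, h⟩

/-- The invariant is indexed by the number of completed iterations, which is known in advance to be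
`n`. Each iteration pays one step for the test, and the last, failing test pays one more. -/
theorem runs_loop {c : Test} {p : Program} {T n : ℕ} (I : ℕ → State → Prop) {s : State}
    (h0 : I 0 s) (hstep : ∀ j < n, ∀ s, I j s → c.holds s ∧ Runs p s T (I (j + 1)))
    (hend : ∀ s, I n s → ¬ c.holds s) : Runs (.loop c p) s (n * (T + 1) + 1) (I n) := by
  suffices h : ∀ m j, j + m = n → ∀ s, I j s → Runs (.loop c p) s (m * (T + 1) + 1) (I n) from
    h n 0 (by omega) s h0
  intro m
  induction m with
  | zero =>
    intro j hj s hs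
    obtain rfl : j = n := by omega
    exact ⟨1, s, .loop_false (hend s hs), by omega, hs⟩
  | succ m ih =>
    intro j hj s hs
    obtain ⟨hc, t, s', e, ht, hI⟩ := hstep j (by omega) s hs
    obtain ⟨t', s'', e', ht', hI'⟩ := ih (j + 1) (by omega) s' hI
    exact ⟨_, s'', .loop_true hc e e', by rw [Nat.succ_mul]; omega, hI'⟩

/-- Runs `p` with the register `i` increasing up to the bound in the register `e`. -/
def loopUp (i e : ℕ) (p : Program) : Program :=
  .loop (.lt i e) (.seq p (.instr (.inc i)))

/-- The counter value and the frame conditions are carried in a strengthened invariant, so that `I`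
has to mention only what the body changes. The 2 in `T + 2` pays for the increment and the test. -/
theorem runs_loopUp {i e : ℕ} {p : Program} {T n a : ℕ} (I : ℕ → State → Prop) {s : State}
    (hpi : p.writes i = false) (hpe : p.writes e = false) (hie : i ≠ e)
    (hi : s.reg i = a) (he : s.reg e = a + n) (h0 : I 0 s)
    (hstep : ∀ j < n, ∀ s', I j s' → s'.reg i = a + j →
      (∀ b, (loopUp i e p).writes b = false → s'.reg b = s.reg b) →
      ((loopUp i e p).stores = false → s'.mem = s.mem) →
      Runs p s' T (fun s'' => I (j + 1) ((Instr.inc i).run s''))) :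
    Runs (loopUp i e p) s (n * (T + 2) + 1) (I n) := by
  have hw : ∀ b, (loopUp i e p).writes b = false ↔ p.writes b = false ∧ b ≠ i := by
    intro b; simp [loopUp, Program.writes, Instr.writes]
  have hst : (loopUp i e p).stores = false ↔ p.stores = false := by
    simp [loopUp, Program.stores, Instr.stores]
  have := runs_loop (c := .lt i e) (p := .seq p (.instr (.inc i))) (T := T + 1) (n := n)
    (fun j s' => I j s' ∧ s'.reg i = a + j ∧
      (∀ b, (loopUp i e p).writes b = false → s'.reg b = s.reg b) ∧
      ((loopUp i e p).stores = false → s'.mem = s.mem)) (s := s)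
    ⟨h0, hi, fun _ _ => rfl, fun _ => rfl⟩ ?_ ?_
  · exact this.mono le_rfl fun s' h => h.1
  · rintro j hj s' ⟨hI, hr, hf, hm⟩
    have hee : s'.reg e = a + n := by rw [hf e ((hw e).2 ⟨hpe, hie.symm⟩), he]
    refine ⟨by simp only [Test.holds]; omega, runs_seq ?_⟩
    refine (hstep j hj s' hI hr hf hm).conseq le_rfl fun s'' h hreg hmem => runs_instr ?_
    refine ⟨h, ?_, ?_, ?_⟩
    · simp [Instr.run, hreg i hpi, hr]; omega
    · intro b hb
      have := (hw b).1 hb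
      simp [Instr.run, Function.update, this.2, hreg b this.1, hf b hb]
    · intro hb
      simp [Instr.run, hmem (hst.1 hb), hm hb]
  · rintro s' ⟨hI, hr, hf, hm⟩
    have hee : s'.reg e = a + n := by rw [hf e ((hw e).2 ⟨hpe, hie.symm⟩), he]
    simp only [Test.holds]; omega

/-! ### The programs

Registers: 0 to 2 hold `k`, `d`, `r`; 3 holds `k + r * k`, 4 holds 0 and 5 holds 1. A message is
kept in the memory cells below `k`, the columns of a matrix in those from `k` to `k + r * k`. -/

infixr:60 " ;; " => Program.seq

/-- An instruction without effect on the registers in use. -/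
def skip : Program := .instr (.const 6 0)

/-! ### Binary counters -/

/-- The binary digits of a number. -/
def bitAt (N i : ℕ) : ℕ := N / 2 ^ i % 2

theorem bitAt_lt (N i : ℕ) : bitAt N i < 2 := Nat.mod_lt _ (by norm_num)

/-- The quotient by `2 ^ i` grows by one exactly when `2 ^ i` divides `N + 1`: this divisibility is
the carry into digit `i`. -/
theorem bitAt_succ (N i : ℕ) :
    bitAt (N + 1) i = (bitAt N i + if 2 ^ i ∣ N + 1 then 1 else 0) % 2 := by
  simp only [bitAt, Nat.succ_div]
  split <;> omega

/-- The carry passes digit `i` exactly when it arrives there and meets the digit 1. -/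
theorem two_pow_succ_dvd_iff (N i : ℕ) :
    2 ^ (i + 1) ∣ N + 1 ↔ 2 ^ i ∣ N + 1 ∧ bitAt N i = 1 := by
  constructor
  · intro h
    have h1 : 2 ^ i ∣ N + 1 := (pow_dvd_pow 2 (Nat.le_succ i)).trans h
    refine ⟨h1, ?_⟩
    obtain ⟨c, hc⟩ := h
    have h2 : bitAt (N + 1) i = 0 := by
      rw [bitAt, hc, pow_succ, mul_assoc, Nat.mul_div_cancel_left _ (by positivity)]
      omega
    have := bitAt_succ N i
    have := bitAt_lt N i
    simp only [h1, if_true] at *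
    omega
  · rintro ⟨⟨c, hc⟩, h2⟩
    have h3 := bitAt_succ N i
    rw [if_pos ⟨c, hc⟩, h2, bitAt, hc, Nat.mul_div_cancel_left _ (by positivity)] at h3
    rw [hc, pow_succ]
    exact Nat.mul_dvd_mul_left _ (Nat.dvd_of_mod_eq_zero h3)

/-- One step of the increment of a binary counter: adds the carry (register 16) to the digit at
the address in register 17. -/
def carryStep : Program :=
  .instr (.load 10 17) ;;
  .branch (.eq 16 5)
    (.branch (.eq 10 5) (.instr (.store 17 4)) (.instr (.store 17 5) ;; .instr (.const 16 0)))
    skip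

/-- The carry into position `j` is the divisibility of `N + 1` by `2 ^ j`, so the carry left after
`n` digits signals overflow. It later serves as the exit test of the enumerations. -/
theorem runs_carry {e : ℕ} {s : State} {a n N : ℕ} (he : e ≠ 10 ∧ e ≠ 16 ∧ e ≠ 6 ∧ e ≠ 17)
    (h17 : s.reg 17 = a) (hr : s.reg e = a + n) (h16 : s.reg 16 = 1) (h4 : s.reg 4 = 0)
    (h5 : s.reg 5 = 1) (hm : ∀ i < n, s.mem (a + i) = bitAt N i) :
    Runs (loopUp 17 e carryStep) s (n * 7 + 1) (fun s' =>
      (s'.reg 16 = if 2 ^ n ∣ N + 1 then 1 else 0) ∧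
      (∀ i < n, s'.mem (a + i) = bitAt (N + 1) i) ∧
      ∀ b, b < a ∨ a + n ≤ b → s'.mem b = s.mem b) := by
  have key := runs_loopUp (i := 17) (e := e) (p := carryStep) (T := 5) (n := n) (a := a) (s := s)
    (fun j s' => (s'.reg 16 = if 2 ^ j ∣ N + 1 then 1 else 0) ∧
      (∀ i < n, s'.mem (a + i) = if i < j then bitAt (N + 1) i else bitAt N i) ∧
      ∀ b, b < a ∨ a + n ≤ b → s'.mem b = s.mem b)
    rfl (by simp [carryStep, skip, Program.writes, Instr.writes, he]) he.2.2.2.symm h17 hr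
    ⟨by simp [h16], by simpa using hm, fun _ _ => rfl⟩ ?_
  · refine key.mono le_rfl fun s' h => ⟨h.1, fun i hi => ?_, h.2.2⟩
    rw [h.2.1 i hi, if_pos hi]
  · rintro j hj s' ⟨hc, hb, ho⟩ hi hf -
    have h4' : s'.reg 4 = 0 := (hf 4 rfl).trans h4
    have h5' : s'.reg 5 = 1 := (hf 5 rfl).trans h5
    have hv : s'.mem (a + j) = bitAt N j := by rw [hb j hj, if_neg (lt_irrefl _)]
    have h2 := bitAt_lt N j
    have h3 := bitAt_succ N j
    have h6 := two_pow_succ_dvd_iff N j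
    -- Only the cell of digit `j` may change, so in every branch the memory part of the invariant
    -- reduces to the new value of this digit.
    have mem_case : ∀ m : ℕ → ℕ, (∀ b, b ≠ a + j → m b = s'.mem b) →
        m (a + j) = bitAt (N + 1) j →
        (∀ i < n, m (a + i) = if i < j + 1 then bitAt (N + 1) i else bitAt N i) ∧
        ∀ b, b < a ∨ a + n ≤ b → m b = s.mem b := by
      intro m hm1 hm2
      refine ⟨fun i hin => ?_, fun b hb' => ?_⟩
      · by_cases hij : i = j
        · subst hij; rw [hm2, if_pos (Nat.lt_succ_self _)]
        · rw [hm1 _ (by omega), hb i hin]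
          have : i < j + 1 ↔ i < j := by omega
          simp only [this]
      · rw [hm1 _ (by omega), ho b hb']
    refine Runs.mono (T := ?T) ?h ?hT (fun _ h => h)
    case h =>
      refine runs_seq (runs_instr (runs_branch (fun h => runs_branch (fun h' => runs_instr ?_)
        (fun h' => runs_seq (runs_instr (runs_instr ?_)))) (fun h => runs_instr ?_)))
      · simp [Test.holds, Instr.run, h5', hc, hv, hi] at h h'
        refine ⟨by simp [Instr.run, hc, h6, h, h'], mem_case _ ?_ ?_⟩
        · intro b hb'; simp [Instr.run, hi, hb']
        · simp [Instr.run, hi, h4', h3, h, h']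
      · simp [Test.holds, Instr.run, h5', hc, hv, hi] at h h'
        refine ⟨by simp [Instr.run, h6, h'], mem_case _ ?_ ?_⟩
        · intro b hb'; simp [Instr.run, hi, hb']
        · simp [Instr.run, hi, h5', h3, h]; omega
      · simp [Test.holds, Instr.run, h5', hc] at h
        refine ⟨by simp [Instr.run, hc, h6, h], mem_case _ (fun _ _ => rfl) ?_⟩
        simp [Instr.run, hv, h3, h]; omega
    case hT => simp

/-- Sets the carry and increments the message. -/
def incMessage : Program :=
  .instr (.const 16 1) ;; .instr (.const 17 0) ;; loopUp 17 0 carryStep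

/-- Sets the carry and increments the matrix. -/
def incMatrix : Program :=
  .instr (.const 16 1) ;; .instr (.copy 17 0) ;; loopUp 17 3 carryStep

/-! ### Checking one message against a matrix -/

/-- Adds the inner product of the message with the column at the address in register 9 to the
parity in register 12. -/
def columnParity : Program :=
  loopUp 7 0 (.instr (.load 10 7) ;; .instr (.load 11 9) ;;
    .branch (.eq 10 5)
      (.branch (.eq 11 5)
        (.branch (.eq 12 5) (.instr (.const 12 0)) (.instr (.const 12 1))) skip) skip ;;
    .instr (.inc 9))

/-- The final value of register 9 matters: it is the start of the next column, so the loop over the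
columns needs no multiplication. -/
theorem runs_columnParity {s : State} {k q : ℕ} {x g : ℕ → ℕ} (h0 : s.reg 0 = k)
    (h5 : s.reg 5 = 1) (h7 : s.reg 7 = 0) (h9 : s.reg 9 = q) (h12 : s.reg 12 = 0)
    (hx : ∀ i < k, s.mem i = x i) (hg : ∀ i < k, s.mem (q + i) = g i)
    (hx2 : ∀ i, x i < 2) (hg2 : ∀ i, g i < 2) :
    Runs columnParity s (k * 9 + 1) (fun s' =>
      s'.reg 12 = (∑ i ∈ Finset.range k, x i * g i) % 2 ∧ s'.reg 9 = q + k) := by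
  refine runs_loopUp (a := 0) (T := 7) (fun j s' =>
      s'.reg 12 = (∑ i ∈ Finset.range j, x i * g i) % 2 ∧ s'.reg 9 = q + j)
    rfl rfl (by decide) h7 (by simpa using h0) (by simp [h12, h9]) ?_
  rintro j hj s' ⟨hp, hq⟩ hi hf hm
  have h5' : s'.reg 5 = 1 := (hf 5 rfl).trans h5
  have hm' := hm rfl
  have hxj := hx j hj
  have hgj := hg j hj
  have hxj2 := hx2 j
  have hgj2 := hg2 j
  simp only [zero_add] at hi
  refine Runs.mono (T := ?T) ?h ?hT (fun _ h => h)
  case h =>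
    refine runs_seq (runs_instr (runs_seq (runs_instr (runs_seq (runs_branch
      (fun h => runs_branch (fun h' => runs_branch
        (fun h'' => runs_instr (runs_instr ?_)) (fun h'' => runs_instr (runs_instr ?_)))
        (fun h' => runs_instr (runs_instr ?_))) (fun h => runs_instr (runs_instr ?_)))))))
    all_goals
      simp only [Test.holds, Instr.run, Function.update_apply] at *
      simp [h5', hi, hq, hp, hm', hxj, hgj] at *
      rw [Finset.sum_range_succ]
    · simp [h, h', add_assoc]; omega
    · simp [h, h', add_assoc]; omega
    · have : g j = 0 := by omega
      simp [this, add_assoc]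
    · have : x j = 0 := by omega
      simp [this, add_assoc]
  case hT => simp

/-- Adds the weight of the message to register 13. -/
def messageWeight : Program :=
  loopUp 7 0 (.instr (.load 10 7) ;; .branch (.eq 10 5) (.instr (.inc 13)) skip)

theorem runs_messageWeight {s : State} {k : ℕ} {x : ℕ → ℕ} (h0 : s.reg 0 = k) (h5 : s.reg 5 = 1)
    (h7 : s.reg 7 = 0) (h13 : s.reg 13 = 0) (hx : ∀ i < k, s.mem i = x i) (hx2 : ∀ i, x i < 2) :
    Runs messageWeight s (k * 5 + 1) (fun s' => s'.reg 13 = ∑ i ∈ Finset.range k, x i) := by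
  refine runs_loopUp (a := 0) (T := 3) (fun j s' => s'.reg 13 = ∑ i ∈ Finset.range j, x i)
    rfl rfl (by decide) h7 (by simpa using h0) (by simp [h13]) ?_
  rintro j hj s' hp hi hf hm
  have h5' : s'.reg 5 = 1 := (hf 5 rfl).trans h5
  have hm' := hm rfl
  have hxj := hx j hj
  have hxj2 := hx2 j
  simp only [zero_add] at hi
  refine Runs.mono (T := ?T) ?h ?hT (fun _ h => h)
  case h =>
    refine runs_seq (runs_instr (runs_branch (fun h => runs_instr ?_) (fun h => runs_instr ?_)))
    all_goals
      simp only [Test.holds, Instr.run, Function.update_apply] at *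
      simp [h5', hi, hp, hm', hxj] at *
      rw [Finset.sum_range_succ]
      omega
  case hT => simp

/-- The weight of the parity bits of the message `x` for the `k × r` matrix whose columns are
listed by `g`. -/
def parityWeight (k r : ℕ) (x g : ℕ → ℕ) : ℕ :=
  ∑ j ∈ Finset.range r, (∑ i ∈ Finset.range k, x i * g (j * k + i)) % 2

/-- Adds the weight of the parity bits to register 13. -/
def parityLoop : Program :=
  loopUp 8 2 (.instr (.const 12 0) ;; .instr (.const 7 0) ;; columnParity ;;
    .branch (.eq 12 5) (.instr (.inc 13)) skip)

theorem column_index_lt {i j k r : ℕ} (hi : i < k) (hj : j < r) : j * k + i < r * k := by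
  calc j * k + i < j * k + k := by omega
    _ = (j + 1) * k := by ring
    _ ≤ r * k := Nat.mul_le_mul_right _ hj

theorem runs_parityLoop {s : State} {k r w : ℕ} {x g : ℕ → ℕ} (h0 : s.reg 0 = k)
    (h2 : s.reg 2 = r) (h5 : s.reg 5 = 1) (h8 : s.reg 8 = 0) (h9 : s.reg 9 = k)
    (h13 : s.reg 13 = w) (hx : ∀ i < k, s.mem i = x i) (hg : ∀ q < r * k, s.mem (k + q) = g q)
    (hx2 : ∀ i, x i < 2) (hg2 : ∀ i, g i < 2) :
    Runs parityLoop s (r * (k * 9 + 7) + 1) (fun s' => s'.reg 13 = w + parityWeight k r x g) := by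
  refine (runs_loopUp (a := 0) (T := k * 9 + 5) (fun j s' =>
      s'.reg 13 = w + parityWeight k j x g ∧ s'.reg 9 = k + j * k)
    rfl rfl (by decide) h8 (by simpa using h2) (by simp [h13, h9, parityWeight]) ?_).mono le_rfl
    (fun s' h => h.1)
  rintro j hj s' ⟨hp, hq⟩ hi hf hm
  have h5' : s'.reg 5 = 1 := (hf 5 rfl).trans h5
  have h0' : s'.reg 0 = k := (hf 0 rfl).trans h0
  have hm' := hm rfl
  refine Runs.mono (T := ?T) ?h ?hT (fun _ h => h)
  case h =>
    refine runs_seq (runs_instr (runs_seq (runs_instr (runs_seq ((runs_columnParity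
      (k := k) (q := k + j * k) (x := x) (g := fun i => g (j * k + i)) ?_ ?_ ?_ ?_ ?_ ?_ ?_ hx2
      (fun _ => hg2 _)).conseq
      le_rfl (fun s'' h hreg _ => (runs_branch (fun h' => runs_instr ?_)
        (fun h' => runs_instr ?_))))))))
    · simpa [Instr.run] using h0'
    · simpa [Instr.run] using h5'
    · simp [Instr.run]
    · simpa [Instr.run] using hq
    · simp [Instr.run]
    · intro i hi'
      simp [Instr.run, hm', hx i hi']
    · intro i hi'
      simp only [Instr.run, hm', add_assoc]
      exact hg _ (column_index_lt hi' hj)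
    all_goals
      have e5 := hreg 5 rfl
      have e13 := hreg 13 rfl
      simp only [Test.holds, Instr.run, Function.update_apply] at *
      simp [h5', hp, e5] at *
      simp only [parityWeight, Finset.sum_range_succ] at *
      refine ⟨by omega, by rw [h.2]; ring⟩
  case hT => simp; omega

/-- Clears register 15 if the message gives a word of too low a weight or no parity bits. -/
def checkMessage : Program :=
  .instr (.const 13 0) ;; .instr (.const 7 0) ;; messageWeight ;; .instr (.copy 14 13) ;;
  .instr (.copy 9 0) ;; .instr (.const 8 0) ;; parityLoop ;;
  .branch (.eq 13 14) (.instr (.const 15 0)) skip ;;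
  .branch (.lt 13 1) (.instr (.const 15 0)) skip

/-- The message `x` is encoded, with parity bits that are not all zero, as a word of weight at
least `d`. -/
def MessageOk (k d r : ℕ) (x g : ℕ → ℕ) : Prop :=
  0 < parityWeight k r x g ∧ d ≤ ∑ i ∈ Finset.range k, x i + parityWeight k r x g

open Classical in
-- The message weight is saved in register 14 before the parity bits are added to register 13, so
-- the two agree exactly when all parity bits vanish. Register 15 is only ever cleared, and thus
-- accumulates a conjunction over the messages.
theorem runs_checkMessage {s : State} {k d r : ℕ} {x g : ℕ → ℕ} (h0 : s.reg 0 = k)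
    (h1 : s.reg 1 = d) (h2 : s.reg 2 = r) (h5 : s.reg 5 = 1) (hx : ∀ i < k, s.mem i = x i)
    (hg : ∀ q < r * k, s.mem (k + q) = g q) (hx2 : ∀ i, x i < 2) (hg2 : ∀ i, g i < 2) :
    Runs checkMessage s (k * 5 + r * (k * 9 + 7) + 11)
      (fun s' => s'.reg 15 = if MessageOk k d r x g then s.reg 15 else 0) := by
  refine Runs.mono (T := ?T) ?h ?hT (fun _ h => h)
  case h =>
    refine runs_seq <| runs_instr <| runs_seq <| runs_instr <| runs_seq (T' := 1 + (1 + (1 + (r * (k * 9 + 7) + 1 + 4)))) <|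
      (runs_messageWeight (k := k) (x := x) ?_ ?_ ?_ ?_ ?_ hx2).conseq le_rfl
      fun s1 e1 hr1 hm1 => ?_
    rotate_right
    · refine runs_seq <| runs_instr <| runs_seq <| runs_instr <| runs_seq <| runs_instr <|
        runs_seq (T' := 4) <| (runs_parityLoop (k := k) (r := r) (x := x) (g := g)
          ?_ ?_ ?_ ?_ ?_ rfl ?_ ?_ hx2 hg2).conseq le_rfl fun s2 e2 hr2 _ => ?_
      rotate_right
      · refine runs_seq (runs_branch (fun h => runs_instr
          (runs_branch (fun h' => runs_instr ?_) (fun h' => runs_instr ?_)))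
          (fun h => runs_instr (runs_branch (fun h' => runs_instr ?_) (fun h' => runs_instr ?_))))
        all_goals
          have f1 := hr1 15 rfl
          have f2 := hr2 15 rfl
          have f3 := hr1 1 rfl
          have f4 := hr2 1 rfl
          have f5 := hr2 14 rfl
          simp [Instr.run] at f1 f2 f3 f4 f5 e1 e2
          simp [Test.holds, Instr.run, e2, f5, f4, f3, h1, e1] at h h'
          by_cases hM : MessageOk k d r x g <;> simp [Instr.run, f2, f1, hM]
          all_goals
            simp only [MessageOk] at hM
            omega
      · simp [Instr.run, hr1 0 rfl, h0]
      · simp [Instr.run, hr1 2 rfl, h2]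
      · simp [Instr.run, hr1 5 rfl, h5]
      · simp [Instr.run]
      · simp [Instr.run, hr1 0 rfl, h0]
      · intro i hi; simp [Instr.run, hm1 rfl, hx i hi]
      · intro q hq; simp [Instr.run, hm1 rfl, hg q hq]
    · simpa [Instr.run] using h0
    · simpa [Instr.run] using h5
    · simp [Instr.run]
    · simp [Instr.run]
    · simpa [Instr.run] using hx
  case hT => omega

/-! ### Circuits from lists of vertices -/

/-- The description of a vertex: its label and the positions of its predecessors. -/
inductive Desc
  | input (i : ℕ)
  | output (y u : ℕ)
  | not (u : ℕ)
  | and (u v : ℕ)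
  | or (u v : ℕ)

/-- The positions of the predecessors. -/
def Desc.refs : Desc → Finset ℕ
  | .input _ => ∅
  | .output _ u => {u}
  | .not u => {u}
  | .and u v => {u, v}
  | .or u v => {u, v}

/-- The label, where variables out of range are replaced by a gate. -/
def Desc.label (k m : ℕ) : Desc → Label (Fin k) (Fin m)
  | .input i => if h : i < k then .input ⟨i, h⟩ else .gate .not
  | .output y _ => if h : y < m then .output ⟨y, h⟩ else .gate .not
  | .not _ => .gate .not
  | .and _ _ => .gate .and
  | .or _ _ => .gate .or

/-- The memory cells `c 0`, `c 1`, `c 2` hold the description of a vertex. -/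
def Desc.Encodes : Desc → (ℕ → ℕ) → Prop
  | .input i, c => c 0 = 0 ∧ c 1 = i
  | .output y u, c => c 0 = 1 ∧ c 1 = y ∧ c 2 = u
  | .not u, c => c 0 = 2 ∧ c 1 = u
  | .and u v, c => c 0 = 3 ∧ c 1 = u ∧ c 2 = v
  | .or u v, c => c 0 = 4 ∧ c 1 = u ∧ c 2 = v

/-- A vertex with facts about it: the output it belongs to, the signal that leaves it, a set of
input variables that contains those from which a path leads to it, and a bound for the number of
gates on the paths to it. -/
structure Ann (k : ℕ) where
  desc : Desc
  owner : Option ℕ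
  val : (Fin k → ZMod 2) → ZMod 2
  sup : Set (Fin k)
  rank : ℕ

/-- The support of column `j` of the matrix `g`. -/
def columnSupport (k : ℕ) (g : ℕ → ℕ) (j : ℕ) : Set (Fin k) := {i | g (j * k + i) = 1}

/-- The parity bit of column `j` of the matrix `g`, from the first `n` rows. -/
def columnSum (k : ℕ) (g : ℕ → ℕ) (j n : ℕ) (x : Fin k → ZMod 2) : ZMod 2 :=
  ∑ i : Fin k, if (i : ℕ) < n then x i * g (j * k + i) else 0

/-- The facts about `b` allow an edge from the vertex `b`, at the position `u`, to `a`. -/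
structure Link {k : ℕ} (L : List (Ann k)) (v : ℕ) (a : Ann k) (u : ℕ) (b : Ann k) : Prop where
  lt : u < v
  get : L[u]? = some b
  sup : b.sup ⊆ a.sup
  rank : b.rank ≤ a.rank
  owner : b.owner = none ∨ b.owner = a.owner
  no_output : ∀ y w, b.desc ≠ .output y w

/-- The facts about the vertex `a` at the position `v` are consistent with those about its
predecessors. -/
def Consistent {k : ℕ} (g : ℕ → ℕ) (cols : List ℕ) (L : List (Ann k)) (v : ℕ) (a : Ann k) : Prop :=
  match a.desc with
  | .input i => v = i ∧ (∃ h : i < k, (∀ x, a.val x = x ⟨i, h⟩) ∧ a.sup = {⟨i, h⟩}) ∧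
      a.owner = none ∧ a.rank = 0
  | .output y u => (∃ b, Link L v a u b ∧ ∀ x, a.val x = b.val x) ∧ a.owner = some y ∧
      ∃ j, cols[y]? = some j ∧ (∀ x, a.val x = columnSum k g j k x) ∧ a.sup = columnSupport k g j
  | .not u => a.owner ≠ none ∧
      ∃ b, Link L v a u b ∧ b.rank < a.rank ∧ ∀ x, a.val x = 1 + b.val x
  | .and u w => a.owner ≠ none ∧ u ≠ w ∧ ∃ b c, Link L v a u b ∧ Link L v a w c ∧
      b.rank < a.rank ∧ c.rank < a.rank ∧ ∀ x, a.val x = b.val x * c.val x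
  | .or u w => a.owner ≠ none ∧ u ≠ w ∧ ∃ b c, Link L v a u b ∧ Link L v a w c ∧
      b.rank < a.rank ∧ c.rank < a.rank ∧ ∀ x, a.val x = b.val x + c.val x + b.val x * c.val x

theorem Link.append {k : ℕ} {L L' : List (Ann k)} {v u : ℕ} {a b : Ann k} (h : Link L v a u b) :
    Link (L ++ L') v a u b :=
  ⟨h.lt, by rw [List.getElem?_append_left (List.getElem?_eq_some_iff.1 h.get).1, h.get], h.sup,
    h.rank, h.owner, h.no_output⟩

/-- Consistency refers only to listed positions and columns, and appending does not move these. -/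
theorem Consistent.append {k : ℕ} {g : ℕ → ℕ} {cols cols' : List ℕ} {L L' : List (Ann k)} {v : ℕ}
    {a : Ann k} (h : Consistent g cols L v a) : Consistent g (cols ++ cols') (L ++ L') v a := by
  unfold Consistent at *
  split at h
  · exact h
  · obtain ⟨⟨b, hb, hb'⟩, ho, j, hj, h'⟩ := h
    refine ⟨⟨b, hb.append, hb'⟩, ho, j, ?_, h'⟩
    rw [List.getElem?_append_left (List.getElem?_eq_some_iff.1 hj).1, hj]
  · obtain ⟨ho, b, hb, h'⟩ := h
    exact ⟨ho, b, hb.append, h'⟩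
  · obtain ⟨ho, hn, b, c, hb, hc, h'⟩ := h
    exact ⟨ho, hn, b, c, hb.append, hc.append, h'⟩
  · obtain ⟨ho, hn, b, c, hb, hc, h'⟩ := h
    exact ⟨ho, hn, b, c, hb.append, hc.append, h'⟩

/-- A list of vertices with all inputs, and an output for each of the columns `cols`, where the
vertices belong to the first `o` outputs. -/
structure Built {k : ℕ} (g : ℕ → ℕ) (cols : List ℕ) (o : ℕ) (L : List (Ann k)) : Prop where
  consistent : ∀ v a, L[v]? = some a → Consistent g cols L v a
  inputs : ∀ i < k, ∃ a, L[i]? = some a ∧ a.desc = .input i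
  outputs : ∀ y < cols.length, ∃! v : ℕ, ∃ a : Ann k, L[v]? = some a ∧ ∃ u, a.desc = .output y u
  owner_lt : ∀ a ∈ L, ∀ y, a.owner = some y → y < o
  rank_le : ∀ a ∈ L, a.rank ≤ 3 * k

theorem Built.append_gate {k : ℕ} {g : ℕ → ℕ} {cols : List ℕ} {o : ℕ} {L : List (Ann k)}
    (h : Built g cols o L) {a : Ann k} (ha : Consistent g cols (L ++ [a]) L.length a)
    (hd : ∀ y u, a.desc ≠ .output y u) (ho : ∀ y, a.owner = some y → y < o)
    (hr : a.rank ≤ 3 * k) : Built g cols o (L ++ [a]) where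
  consistent v b hb := by
    rcases lt_or_ge v L.length with hv | hv
    · rw [List.getElem?_append_left hv] at hb
      simpa using (h.consistent v b hb).append (cols' := []) (L' := [a])
    · have := (List.getElem?_eq_some_iff.1 hb).1
      obtain rfl : v = L.length := by simp at this; omega
      simp at hb
      exact hb ▸ ha
  inputs i hi := by
    obtain ⟨b, hb, hb'⟩ := h.inputs i hi
    exact ⟨b, by rw [List.getElem?_append_left (List.getElem?_eq_some_iff.1 hb).1, hb], hb'⟩
  outputs y hy := by
    obtain ⟨v, ⟨b, hb, u, hu⟩, huniq⟩ := h.outputs y hy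
    refine ⟨v, ⟨b, ?_, u, hu⟩, ?_⟩
    · rw [List.getElem?_append_left (List.getElem?_eq_some_iff.1 hb).1, hb]
    · rintro w ⟨c, hc, u', hu'⟩
      have := (List.getElem?_eq_some_iff.1 hc).1
      rcases lt_or_ge w L.length with hw | hw
      · rw [List.getElem?_append_left hw] at hc
        exact huniq w ⟨c, hc, u', hu'⟩
      · obtain rfl : w = L.length := by simp at this; omega
        simp at hc
        exact absurd hu' (hc ▸ hd y u')
  owner_lt b hb y hy := by
    rcases List.mem_append.1 hb with hb | hb
    · exact h.owner_lt b hb y hy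
    · simp at hb; subst hb; exact ho y hy
  rank_le b hb := by
    rcases List.mem_append.1 hb with hb | hb
    · exact h.rank_le b hb
    · simp at hb; subst hb; exact hr

/-- While a column is under construction its gates already belong to output `cols.length`, so the
owner bound runs one ahead of `cols`. The output vertex makes the two agree again. -/
theorem Built.append_output {k : ℕ} {g : ℕ → ℕ} {cols : List ℕ} {j : ℕ} {L : List (Ann k)}
    (h : Built g cols (cols.length + 1) L) {u : ℕ} {b : Ann k} (hu : L[u]? = some b)
    (hv : ∀ x, b.val x = columnSum k g j k x) (hs : b.sup ⊆ columnSupport k g j)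
    (ho : b.owner = none ∨ b.owner = some cols.length) (hd : ∀ y w, b.desc ≠ .output y w) :
    Built g (cols ++ [j]) (cols.length + 1)
      (L ++ [⟨.output cols.length u, some cols.length, columnSum k g j k,
        columnSupport k g j, b.rank⟩]) where
  consistent v c hc := by
    rcases lt_or_ge v L.length with hv' | hv'
    · rw [List.getElem?_append_left hv'] at hc
      exact (h.consistent v c hc).append
    · have := (List.getElem?_eq_some_iff.1 hc).1
      obtain rfl : v = L.length := by simp at this; omega
      simp at hc
      subst hc
      have hul := (List.getElem?_eq_some_iff.1 hu).1
      refine ⟨⟨b, ⟨hul, ?_, hs, le_rfl, ho, hd⟩, fun x => (hv x).symm⟩, rfl, j, by simp,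
        fun _ => rfl, rfl⟩
      rw [List.getElem?_append_left hul, hu]
  inputs i hi := by
    obtain ⟨b, hb, hb'⟩ := h.inputs i hi
    exact ⟨b, by rw [List.getElem?_append_left (List.getElem?_eq_some_iff.1 hb).1, hb], hb'⟩
  outputs y hy := by
    rcases lt_or_ge y cols.length with hy' | hy'
    · obtain ⟨v, ⟨b, hb, u, hu⟩, huniq⟩ := h.outputs y hy'
      refine ⟨v, ⟨b, ?_, u, hu⟩, ?_⟩
      · rw [List.getElem?_append_left (List.getElem?_eq_some_iff.1 hb).1, hb]
      · rintro w ⟨c, hc, u', hu'⟩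
        have := (List.getElem?_eq_some_iff.1 hc).1
        rcases lt_or_ge w L.length with hw | hw
        · rw [List.getElem?_append_left hw] at hc
          exact huniq w ⟨c, hc, u', hu'⟩
        · obtain rfl : w = L.length := by simp at this; omega
          simp at hc
          rw [← hc] at hu'
          simp at hu'
          omega
    · obtain rfl : y = cols.length := by simp at hy; omega
      refine ⟨L.length, ⟨_, List.getElem?_concat_length, u, rfl⟩, ?_⟩
      rintro w ⟨c, hc, u', hu'⟩
      have := (List.getElem?_eq_some_iff.1 hc).1
      rcases lt_or_ge w L.length with hw | hw
      · rw [List.getElem?_append_left hw] at hc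
        -- An earlier output vertex with this number would, by consistency, already have a column in
        -- `cols`.
        have hcc := h.consistent w c hc
        rw [Consistent, hu'] at hcc
        obtain ⟨-, -, i, hi, -⟩ := hcc
        simp at hi
      · simp at this; omega
  owner_lt b hb y hy := by
    rcases List.mem_append.1 hb with hb | hb
    · exact h.owner_lt b hb y hy
    · simp at hb; subst hb; simp at hy; omega
  rank_le c hc := by
    rcases List.mem_append.1 hc with hc | hc
    · exact h.rank_le c hc
    · simp at hc; subst hc; exact h.rank_le b (List.mem_of_getElem? hu)

theorem Built.le_length {k : ℕ} {g : ℕ → ℕ} {cols : List ℕ} {o : ℕ} {L : List (Ann k)}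
    (h : Built g cols o L) : k ≤ L.length := by
  rcases Nat.eq_zero_or_pos k with rfl | hk
  · exact Nat.zero_le _
  · obtain ⟨a, ha, -⟩ := h.inputs (k - 1) (by omega)
    have := (List.getElem?_eq_some_iff.1 ha).1
    omega

/-- The input vertices. -/
def inputList (k : ℕ) : List (Ann k) :=
  (List.finRange k).map fun i : Fin k => ⟨.input i, none, fun x => x i, {i}, 0⟩

theorem inputList_map_desc (k : ℕ) : (inputList k).map Ann.desc = (List.range k).map Desc.input := by
  apply List.ext_getElem <;> simp [inputList]

theorem inputList_getElem? {k i : ℕ} (h : i < k) :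
    (inputList k)[i]? = some ⟨.input i, none, fun x => x ⟨i, h⟩, {⟨i, h⟩}, 0⟩ := by
  simp [inputList, h]

theorem built_inputList (k : ℕ) (g : ℕ → ℕ) : Built g [] 0 (inputList k) where
  consistent v a ha := by
    have hv : v < k := by simpa [inputList] using (List.getElem?_eq_some_iff.1 ha).1
    rw [inputList_getElem? hv] at ha
    simp at ha
    subst ha
    exact ⟨rfl, ⟨hv, fun _ => rfl, rfl⟩, rfl, rfl⟩
  inputs i hi := ⟨_, inputList_getElem? hi, rfl⟩
  outputs y hy := absurd hy (by simp)
  owner_lt a ha y hy := by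
    simp [inputList] at ha
    obtain ⟨i, rfl⟩ := ha
    simp at hy
  rank_le a ha := by
    simp [inputList] at ha
    obtain ⟨i, rfl⟩ := ha
    simp

/-- The state of the construction of column `j`, after `n` of its rows: `acc` is the position of
the vertex that carries the sum of these rows, if it has an entry there. -/
structure Partial {k : ℕ} (g : ℕ → ℕ) (cols : List ℕ) (j n : ℕ) (L : List (Ann k)) (acc : ℕ)
    (b : Ann k) : Prop where
  get : L[acc]? = some b
  val : ∀ x, b.val x = columnSum k g j n x
  sup : b.sup ⊆ columnSupport k g j
  rank : b.rank ≤ 3 * n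
  owner : b.owner = none ∨ b.owner = some cols.length
  no_output : ∀ y w, b.desc ≠ .output y w
  acc_ne : acc < n ∨ k ≤ acc

theorem columnSum_succ {k : ℕ} (g : ℕ → ℕ) (j : ℕ) {n : ℕ} (hn : n < k) (x : Fin k → ZMod 2) :
    columnSum k g j (n + 1) x = columnSum k g j n x + x ⟨n, hn⟩ * g (j * k + n) := by
  have : x ⟨n, hn⟩ * g (j * k + n) =
      ∑ i : Fin k, if i = ⟨n, hn⟩ then x i * g (j * k + i) else 0 := by simp
  rw [columnSum, columnSum, this, ← Finset.sum_add_distrib]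
  refine Finset.sum_congr rfl fun i _ => ?_
  have e : i = ⟨n, hn⟩ ↔ (i : ℕ) = n := Fin.ext_iff
  rcases lt_trichotomy (i : ℕ) n with h | h | h
  · simp [h, e, h.ne, Nat.lt_succ_of_lt h]
  · simp [h, e]
  · simp [e, h.ne', not_lt.2 h.le]; intro; omega

theorem Partial.skip_row {k : ℕ} {g : ℕ → ℕ} {cols : List ℕ} {j n : ℕ} {L : List (Ann k)} {acc : ℕ}
    {b : Ann k} (h : Partial g cols j n L acc b) (hn : n < k) (hg : g (j * k + n) = 0) :
    Partial g cols j (n + 1) L acc b :=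
  { h with
    val := fun x => by rw [h.val, columnSum_succ g j hn, hg]; simp
    rank := h.rank.trans (by omega)
    acc_ne := h.acc_ne.imp (fun h => by omega) id }

/-- The first entry of a column needs no gate: the input vertex itself carries the partial sum. -/
theorem Built.first_row {k : ℕ} {g : ℕ → ℕ} {cols : List ℕ} {j n o : ℕ} {L : List (Ann k)}
    (h : Built g cols o L) (hn : n < k) (hg : g (j * k + n) = 1)
    (hz : ∀ i < n, g (j * k + i) = 0) : ∃ b, Partial g cols j (n + 1) L n b := by
  obtain ⟨b, hb, hd⟩ := h.inputs n hn
  have hc := h.consistent n b hb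
  rw [Consistent, hd] at hc
  obtain ⟨-, ⟨_, hv, hs⟩, ho, hr⟩ := hc
  refine ⟨b, hb, fun x => ?_, ?_, by omega, Or.inl ho, by simp [hd], Or.inl (by omega)⟩
  · rw [columnSum_succ g j hn, hv, hg, columnSum, Finset.sum_eq_zero]
    · simp
    · intro i _
      split
      · rename_i hi; simp [hz i hi]
      · rfl
  · rw [hs]
    rintro _ rfl
    exact hg

/-- The gates that add the input `n` to the signal of the vertex `acc`, from the position `l` on. -/
def xorGates (acc n l : ℕ) : List Desc := [.and acc n, .not l, .or acc n, .and (l + 1) (l + 2)]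

/-- Exclusive or is computed as `¬(p ∧ q) ∧ (p ∨ q)`, with four gates and depth three. This is where
the constants in `4 * k` and `3 * k` come from. -/
theorem Built.xor_row {k : ℕ} {g : ℕ → ℕ} {cols : List ℕ} {j n acc : ℕ} {L : List (Ann k)}
    {b : Ann k} (h : Built g cols (cols.length + 1) L) (hb : Partial g cols j n L acc b)
    (hn : n < k) (hg : g (j * k + n) = 1) :
    ∃ (L' : List (Ann k)) (b' : Ann k), L'.map Ann.desc = L.map Ann.desc ++ xorGates acc n L.length ∧
      Built g cols (cols.length + 1) L' ∧ Partial g cols j (n + 1) L' (L.length + 3) b' := by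
  obtain ⟨c, hc, hd⟩ := h.inputs n hn
  have hcc := h.consistent n c hc
  rw [Consistent, hd] at hcc
  obtain ⟨-, ⟨_, hv, hs⟩, ho, hr⟩ := hcc
  have hsup : c.sup ⊆ columnSupport k g j := by
    rw [hs]
    rintro _ rfl
    exact hg
  have hacc := (List.getElem?_eq_some_iff.1 hb.get).1
  have hnl := (List.getElem?_eq_some_iff.1 hc).1
  -- Fan-in is counted by the set of predecessors, so the two arguments of a gate must be different
  -- vertices. The accumulator is an earlier input or lies behind all inputs.
  have hne : acc ≠ n := by have := hb.acc_ne; omega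
  have hbr := hb.rank
  have hkl := h.le_length
  let o := some cols.length
  let S := columnSupport k g j
  let a0 : Ann k := ⟨.and acc n, o, fun x => b.val x * c.val x, S, 3 * n + 1⟩
  let a1 : Ann k := ⟨.not L.length, o, fun x => 1 + b.val x * c.val x, S, 3 * n + 2⟩
  let a2 : Ann k := ⟨.or acc n, o, fun x => b.val x + c.val x + b.val x * c.val x, S, 3 * n + 1⟩
  let a3 : Ann k := ⟨.and (L.length + 1) (L.length + 2), o,
    fun x => (1 + b.val x * c.val x) * (b.val x + c.val x + b.val x * c.val x), S, 3 * n + 3⟩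
  have hown : ∀ y, o = some y → y < cols.length + 1 := by
    intro y hy
    simp only [o, Option.some.injEq] at hy
    omega
  -- The first and third gates have the same two predecessors, the accumulator and the input `n`.
  have l0 : ∀ (a : Ann k) v L', L.length ≤ v → a.sup = S → a.owner = o → 3 * n + 1 ≤ a.rank →
      Link (L ++ L') v a acc b ∧ Link (L ++ L') v a n c := by
    intro a v L' hL e1 e2 e3
    refine ⟨Link.append ⟨by omega, hb.get, e1 ▸ hb.sup, by omega, e2 ▸ hb.owner, hb.no_output⟩,
      Link.append ⟨by omega, hc, e1 ▸ hsup, by omega, Or.inl ho, by simp [hd]⟩⟩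
  have h0 : Built g cols (cols.length + 1) (L ++ [a0]) := by
    refine h.append_gate ⟨by simp [a0, o], hne, b, c, (l0 a0 _ _ le_rfl rfl rfl le_rfl).1,
      (l0 a0 _ _ le_rfl rfl rfl le_rfl).2, ?_, ?_, fun _ => rfl⟩ (by simp [a0]) hown ?_
    all_goals simp only [a0]; omega
  have h1 : Built g cols (cols.length + 1) (L ++ [a0] ++ [a1]) := by
    refine h0.append_gate ⟨by simp [a1, o], a0, ⟨by simp, by simp, le_rfl, by simp [a0, a1],
      Or.inr rfl, by simp [a0]⟩, ?_, fun _ => rfl⟩ (by simp [a1]) hown ?_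
    all_goals simp only [a0, a1]; omega
  have h2 : Built g cols (cols.length + 1) (L ++ [a0] ++ [a1] ++ [a2]) := by
    have l1 := l0 a2 (L ++ [a0] ++ [a1]).length [a0, a1, a2] (by simp) rfl rfl le_rfl
    refine h1.append_gate ⟨by simp [a2, o], hne, b, c, by simpa using l1.1, by simpa using l1.2,
      ?_, ?_, fun _ => rfl⟩ (by simp [a2]) hown ?_
    all_goals simp only [a2]; omega
  have h3 : Built g cols (cols.length + 1) (L ++ [a0] ++ [a1] ++ [a2] ++ [a3]) := by
    refine h2.append_gate ⟨by simp [a3, o], by omega, a1, a2,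
      ⟨by simp, by simp, le_rfl, by simp [a1, a3], Or.inr rfl, by simp [a1]⟩,
      ⟨by simp, by simp, le_rfl, by simp [a2, a3], Or.inr rfl, by simp [a2]⟩,
      ?_, ?_, fun _ => rfl⟩ (by simp [a3]) hown ?_
    all_goals simp only [a1, a2, a3]; omega
  refine ⟨_, a3, ?_, h3, ⟨by simp, fun x => ?_, le_rfl, by simp [a3]; omega,
    Or.inr rfl, by simp [a3], Or.inr (by omega)⟩⟩
  · simp [xorGates, a0, a1, a2, a3]
  · rw [columnSum_succ g j hn, ← hb.val, ← hv x, hg]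
    simp only [a3, Nat.cast_one, mul_one]
    -- What remains is `(1 + p * q) * (p + q + p * q) = p + q` over the field with two elements, a
    -- check of four cases.
    generalize b.val x = p
    generalize c.val x = q
    revert p q
    decide

/-! ### From a consistent list to a circuit -/

theorem Consistent.exists_link {k : ℕ} {g : ℕ → ℕ} {cols : List ℕ} {L : List (Ann k)} {v : ℕ}
    {a : Ann k} (h : Consistent g cols L v a) {u : ℕ} (hu : u ∈ a.desc.refs) :
    ∃ b, Link L v a u b ∧ ((∀ y w, a.desc ≠ .output y w) → b.rank < a.rank) := by
  unfold Consistent at h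
  split at h <;> rename_i hd <;> rw [hd] at hu <;> simp [Desc.refs] at hu
  · obtain ⟨⟨b, hb, -⟩, -⟩ := h
    exact ⟨b, hu ▸ hb, fun h' => absurd hd (h' _ _)⟩
  · obtain ⟨-, b, hb, hr, -⟩ := h
    exact ⟨b, hu ▸ hb, fun _ => hr⟩
  all_goals
    obtain ⟨-, -, b, c, hb, hc, hr, hr', -⟩ := h
    rcases hu with rfl | rfl
    · exact ⟨b, hb, fun _ => hr⟩
    · exact ⟨c, hc, fun _ => hr'⟩

/-- `Desc.label` turns variables out of range into inverters. For inputs a consistent list excludes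
this, so label and description agree. -/
theorem Consistent.label_eq_input {k m : ℕ} {g : ℕ → ℕ} {cols : List ℕ} {L : List (Ann k)} {v : ℕ}
    {a : Ann k} (h : Consistent g cols L v a) (i : Fin k) :
    a.desc.label k m = .input i ↔ a.desc = .input i := by
  unfold Consistent at h
  split at h <;> rename_i hd <;> rw [hd] <;> simp [Desc.label]
  · obtain ⟨-, ⟨hi, -⟩, -⟩ := h
    simp [hi, Fin.ext_iff]
  · split <;> simp

theorem Consistent.label_eq_output {k : ℕ} {g : ℕ → ℕ} {cols : List ℕ} {L : List (Ann k)} {v : ℕ}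
    {a : Ann k} (h : Consistent g cols L v a) (y : Fin cols.length) :
    a.desc.label k cols.length = .output y ↔ ∃ u, a.desc = .output y u := by
  unfold Consistent at h
  split at h <;> rename_i hd <;> rw [hd] <;> simp [Desc.label]
  · split <;> simp
  · obtain ⟨-, -, j, hj, -⟩ := h
    have := (List.getElem?_eq_some_iff.1 hj).1
    simp [this, Fin.ext_iff]

/-- Consistency rules out the default inverter label for variables, and demands distinct arguments
of the binary gates, so the set of predecessors has the size of the fan-in. -/
theorem Consistent.label_eq_gate {k : ℕ} {g : ℕ → ℕ} {cols : List ℕ} {L : List (Ann k)} {v : ℕ}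
    {a : Ann k} (h : Consistent g cols L v a) {e : Gate}
    (he : a.desc.label k cols.length = .gate e) :
    a.desc.refs.card = e.fanIn ∧ ∀ y w, a.desc ≠ .output y w := by
  unfold Consistent at h
  split at h <;> rename_i hd <;> rw [hd] at he ⊢ <;> simp [Desc.label] at he <;>
    simp [Desc.refs]
  · obtain ⟨-, ⟨hi, -⟩, -⟩ := h
    simp [hi] at he
  · obtain ⟨-, -, j, hj, -⟩ := h
    have := (List.getElem?_eq_some_iff.1 hj).1
    simp [this] at he
  · subst he; rfl
  · subst he
    exact Finset.card_pair h.2.1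
  · subst he
    exact Finset.card_pair h.2.1

theorem ncard_fin_mem {n : ℕ} (s : Finset ℕ) (hs : ∀ u ∈ s, u < n) :
    {u : Fin n | (u : ℕ) ∈ s}.ncard = s.card := by
  have : (fun u : Fin n => (u : ℕ)) '' {u : Fin n | (u : ℕ) ∈ s} = s := by
    ext u
    constructor
    · rintro ⟨v, hv, rfl⟩
      exact hv
    · intro hu
      exact ⟨⟨u, hs u hu⟩, hu, rfl⟩
  rw [← Set.ncard_coe_finset, ← this, Set.ncard_image_of_injective _ Fin.val_injective]

namespace Built

variable {k : ℕ} {g : ℕ → ℕ} {cols : List ℕ} {L : List (Ann k)}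

theorem consistent_get {o : ℕ} (h : Built g cols o L) (v : Fin L.length) :
    Consistent g cols L v L[v] :=
  h.consistent v _ (by simp)

theorem exists_link {o : ℕ} (h : Built g cols o L) {u v : Fin L.length}
    (huv : (u : ℕ) ∈ L[v].desc.refs) :
    Link L v L[v] u L[u] ∧ ((∀ y w, L[v].desc ≠ .output y w) → L[u].rank < L[v].rank) := by
  obtain ⟨b, hb, hr⟩ := (h.consistent_get v).exists_link huv
  have : b = L[u] := by
    have := hb.get
    simp at this
    exact this.symm
  exact this ▸ ⟨hb, hr⟩

/-- The circuit with the listed vertices. -/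
def circuit (h : Built g cols cols.length L) : Circuit (Fin k) (Fin cols.length) (Fin L.length) where
  edge u v := (u : ℕ) ∈ L[v].desc.refs
  label v := L[v].desc.label k cols.length
  input_unique i := by
    obtain ⟨a, ha, hd⟩ := h.inputs i i.2
    obtain ⟨hl, ha⟩ := List.getElem?_eq_some_iff.1 ha
    refine ⟨⟨i, hl⟩, ((h.consistent_get ⟨i, hl⟩).label_eq_input i).2 (by simp [ha, hd]), ?_⟩
    intro v hv
    have hc := h.consistent_get v
    have hd := (hc.label_eq_input i).1 hv
    rw [Consistent, hd] at hc
    exact Fin.ext hc.1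
  output_unique y := by
    obtain ⟨v, ⟨a, ha, hd⟩, huniq⟩ := h.outputs y y.2
    obtain ⟨hl, ha⟩ := List.getElem?_eq_some_iff.1 ha
    refine ⟨⟨v, hl⟩, ((h.consistent_get ⟨v, hl⟩).label_eq_output y).2 (by simpa [ha] using hd), ?_⟩
    intro w hw
    exact Fin.ext (huniq w ⟨L[w], by simp, ((h.consistent_get w).label_eq_output y).1 hw⟩)
  input_no_incoming i v hv u huv := by
    rw [((h.consistent_get v).label_eq_input i).1 hv] at huv
    simp [Desc.refs] at huv
  output_no_outgoing y v hv u hvu := by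
    obtain ⟨w, hw⟩ := ((h.consistent_get v).label_eq_output y).1 hv
    exact (h.exists_link hvu).1.no_output _ _ hw
  output_incoming y v hv := by
    obtain ⟨w, hw⟩ := ((h.consistent_get v).label_eq_output y).1 hv
    rw [ncard_fin_mem, hw]
    · simp [Desc.refs]
    · intro u hu
      obtain ⟨b, hb, -⟩ := (h.consistent_get v).exists_link hu
      exact hb.lt.trans v.2
  gate_incoming e v hv := by
    refine (ncard_fin_mem _ ?_).trans ((h.consistent_get v).label_eq_gate hv).1
    intro u hu
    obtain ⟨b, hb, -⟩ := (h.consistent_get v).exists_link hu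
    exact hb.lt.trans v.2
  acyclic v hv := by
    -- Every edge leads to a later position of the list.
    have key : ∀ w, Relation.TransGen (fun u v : Fin L.length => (u : ℕ) ∈ L[v].desc.refs) v w →
        v < w := by
      intro w hw
      induction hw with
      | single e => exact (h.exists_link e).1.lt
      | tail _ e ih => exact ih.trans (h.exists_link e).1.lt
    exact lt_irrefl _ (key v hv)

variable (h : Built g cols cols.length L)

/-- The signals are determined recursively by the local rules, and consistency says that the
annotated values obey the same rules over `ZMod 2`. Predecessors come earlier, so induction on the
position applies. -/
theorem value_circuit (x : Fin k → ZMod 2) (v : Fin L.length) :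
    h.circuit.value x v = L[v].val x := by
  induction v using WellFoundedLT.induction with
  | _ v ih =>
  have hc := h.consistent_get v
  have he : ∀ u, h.circuit.edge u v ↔ (u : ℕ) ∈ L[v].desc.refs := fun u => Iff.rfl
  have hval : ∀ (u : ℕ) (b : Ann k) (hl : Link L v L[v] u b),
      h.circuit.value x ⟨u, hl.lt.trans v.2⟩ = b.val x := by
    intro u b hl
    have hlt := hl.lt
    have hg := hl.get
    rw [ih ⟨u, hlt.trans v.2⟩ hlt]
    obtain ⟨hl', hg⟩ := List.getElem?_eq_some_iff.1 hg
    simp [hg]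
  have hlab : h.circuit.label v = L[v].desc.label k cols.length := rfl
  have two : ∀ z : ZMod 2, z = 0 ∨ z = 1 := by decide
  rw [Circuit.value_eq, Circuit.localValue, hlab]
  generalize L[v] = a at *
  -- `localValue` quantifies over all predecessors. The next three facts express these quantifiers
  -- by the values of the one or two listed ones.
  have ex1 : ∀ u (b : Ann k), Link L v a u b → a.desc.refs = {u} →
      ((∃ w, ∃ _ : h.circuit.edge w v, h.circuit.value x w = 1) ↔ b.val x = 1) := by
    intro u b hl hr
    simp only [he, hr, Finset.mem_singleton, exists_prop]
    constructor
    · rintro ⟨w, rfl, hw⟩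
      rw [← hval _ b hl, hw]
    · exact fun hb => ⟨⟨u, hl.lt.trans v.2⟩, rfl, by rw [hval u b hl, hb]⟩
  have ex2 : ∀ u w (b c : Ann k), Link L v a u b → Link L v a w c → a.desc.refs = {u, w} →
      ((∃ z, ∃ _ : h.circuit.edge z v, h.circuit.value x z = 1) ↔ b.val x = 1 ∨ c.val x = 1) := by
    intro u w b c hl hl' hr
    simp only [he, hr, Finset.mem_singleton, Finset.mem_insert, exists_prop]
    constructor
    · rintro ⟨z, rfl | rfl, hz⟩
      · left; rw [← hval _ b hl, hz]
      · right; rw [← hval _ c hl', hz]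
    · rintro (hb | hb)
      · exact ⟨⟨u, hl.lt.trans v.2⟩, Or.inl rfl, by rw [hval u b hl, hb]⟩
      · exact ⟨⟨w, hl'.lt.trans v.2⟩, Or.inr rfl, by rw [hval w c hl', hb]⟩
  have all2 : ∀ u w (b c : Ann k), Link L v a u b → Link L v a w c → a.desc.refs = {u, w} →
      ((∀ z, ∀ _ : h.circuit.edge z v, h.circuit.value x z = 1) ↔ b.val x = 1 ∧ c.val x = 1) := by
    intro u w b c hl hl' hr
    simp only [he, hr, Finset.mem_singleton, Finset.mem_insert]
    constructor
    · intro hz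
      exact ⟨by rw [← hval u b hl]; exact hz _ (Or.inl rfl),
        by rw [← hval w c hl']; exact hz _ (Or.inr rfl)⟩
    · rintro ⟨hb, hc⟩ z (rfl | rfl)
      · rw [← hb, ← hval _ b hl]
      · rw [← hc, ← hval _ c hl']
  unfold Consistent at hc
  split at hc <;> rename_i hd <;> rw [hd] <;> simp only [Desc.label]
  · obtain ⟨-, ⟨hi, hv, -⟩, -⟩ := hc
    simp [hi, hv]
  · obtain ⟨⟨b, hb, hv⟩, -, j, hj, -⟩ := hc
    have hy := (List.getElem?_eq_some_iff.1 hj).1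
    simp only [hy, dite_true, ex1 _ b hb (by rw [hd]; rfl), hv]
    rcases two (b.val x) with h | h <;> simp [h]
  · obtain ⟨-, b, hb, -, hv⟩ := hc
    simp only [ex1 _ b hb (by rw [hd]; rfl), hv]
    rcases two (b.val x) with h | h <;> simp [h]
    rfl
  · obtain ⟨-, -, b, c, hb, hc, -, -, hv⟩ := hc
    simp only [all2 _ _ b c hb hc (by rw [hd]; rfl), hv]
    rcases two (b.val x) with h | h <;> rcases two (c.val x) with h' | h' <;> simp [h, h']
  · obtain ⟨-, -, b, c, hb, hc, -, -, hv⟩ := hc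
    simp only [ex2 _ _ b c hb hc (by rw [hd]; rfl), hv]
    rcases two (b.val x) with h | h <;> rcases two (c.val x) with h' | h' <;> simp [h, h']
    rfl

theorem label_circuit (v : Fin L.length) :
    h.circuit.label v = L[v].desc.label k cols.length := rfl

theorem outputVertex_desc (y : Fin cols.length) :
    ∃ u, L[h.circuit.outputVertex y].desc = .output y u :=
  ((h.consistent_get _).label_eq_output y).1 (h.circuit.output_unique y).choose_spec.1

theorem outputVertex_spec (y : Fin cols.length) :
    L[h.circuit.outputVertex y].owner = some (y : ℕ) ∧
      (∀ x, L[h.circuit.outputVertex y].val x = columnSum k g cols[y] k x) ∧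
      L[h.circuit.outputVertex y].sup = columnSupport k g cols[y] := by
  obtain ⟨u, hd⟩ := h.outputVertex_desc y
  have hc := h.consistent_get (h.circuit.outputVertex y)
  rw [Consistent, hd] at hc
  obtain ⟨-, ho, j, hj, hv, hs⟩ := hc
  have : cols[y] = j := by simpa using hj
  exact ⟨ho, this ▸ hv, this ▸ hs⟩

theorem eval_circuit (x : Fin k → ZMod 2) (y : Fin cols.length) :
    h.circuit.eval x y = columnSum k g cols[y] k x := by
  rw [Circuit.eval, h.value_circuit, (h.outputVertex_spec y).2.1]

/-- Along each edge the annotated set can only grow, starting from the singleton of an input. The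
inclusion suffices, as optimality needs only an upper bound for the cost of this circuit. -/
theorem support_circuit_subset (y : Fin cols.length) :
    h.circuit.support y ⊆ columnSupport k g cols[y] := by
  intro i hi
  have key : ∀ v, Relation.ReflTransGen h.circuit.edge (h.circuit.inputVertex i) v →
      i ∈ L[v].sup := by
    intro v hv
    induction hv with
    | refl =>
      have hd := ((h.consistent_get _).label_eq_input i).1 (h.circuit.input_unique i).choose_spec.1
      have hc := h.consistent_get (h.circuit.inputVertex i)
      rw [Consistent] at hc
      unfold Circuit.inputVertex at hc ⊢
      rw [hd] at hc
      obtain ⟨-, ⟨_, -, hs⟩, -⟩ := hc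
      rw [hs]
      rfl
    | tail _ e ih => exact (h.exists_link e).1.sup ih
  rw [← (h.outputVertex_spec y).2.2]
  exact key _ hi

theorem owner_eq_none_iff (v : Fin L.length) :
    L[v].owner = none ↔ ∃ i, h.circuit.label v = .input i := by
  have hc := h.consistent_get v
  rw [label_circuit]
  constructor
  · intro hn
    unfold Consistent at hc
    split at hc <;> rename_i hd
    · obtain ⟨-, ⟨hi, -⟩, -⟩ := hc
      exact ⟨⟨_, hi⟩, by rw [hd]; simp [Desc.label, hi]⟩
    · rw [hn] at hc; simp at hc
    · exact absurd hn hc.1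
    · exact absurd hn hc.1
    · exact absurd hn hc.1
  · rintro ⟨i, hi⟩
    have hd := (hc.label_eq_input i).1 hi
    rw [Consistent, hd] at hc
    exact hc.2.2.1

theorem independent_circuit : h.circuit.Independent := by
  -- The sub-circuit of `y` consists of the vertices it owns and all input vertices; the latter may
  -- be shared.
  refine ⟨fun y => {v | L[v].owner = none ∨ L[v].owner = some (y : ℕ)}, fun y => ⟨fun z => ?_, ?_⟩,
    fun v => ?_, fun y z hyz v hv => ?_⟩
  · have := (h.outputVertex_spec z).1
    simp only [Set.mem_ofPred_eq, this, Fin.ext_iff]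
    simp
  · intro u v huv hv
    rcases (h.exists_link huv).1.owner with hu | hu
    · exact Or.inl hu
    · exact hv.imp hu.trans hu.trans
  · rcases ho : L[v].owner with _ | o
    · exact Or.inl ((h.owner_eq_none_iff v).1 ho)
    · exact Or.inr ⟨⟨o, h.owner_lt _ (List.getElem_mem _) o ho⟩, Or.inr ho⟩
  · refine (h.owner_eq_none_iff v).1 ?_
    obtain ⟨hy | hy, hz | hz⟩ := hv
    · exact hy
    · exact hy
    · exact hz
    · rw [hy] at hz
      exact absurd (Fin.ext (Option.some.inj hz)) hyz

theorem rank_lt_of_edge {u v : Fin L.length} (e : h.circuit.edge u v) :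
    L[u].rank ≤ L[v].rank ∧ (v ∈ h.circuit.gates → L[u].rank < L[v].rank) :=
  ⟨(h.exists_link e).1.rank, fun ⟨_, hg⟩ =>
    (h.exists_link e).2 ((h.consistent_get v).label_eq_gate hg).2⟩

theorem rank_pos {v : Fin L.length} (hv : v ∈ h.circuit.gates) : 0 < L[v].rank := by
  obtain ⟨e, he⟩ := hv
  have hc := (h.consistent_get v).label_eq_gate he
  have : 0 < L[v].desc.refs.card := by rw [hc.1]; cases e <;> simp [Gate.fanIn]
  obtain ⟨u, hu⟩ := Finset.card_pos.1 this
  obtain ⟨b, hb, hr⟩ := (h.consistent_get v).exists_link hu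
  exact (Nat.zero_le _).trans_lt (hr hc.2)

/-- The rank never drops along an edge and rises strictly on entering a gate, so a path from `v` has
at most `3 * k` minus the rank of `v` gates after `v`. If `v` is itself a gate, its rank is positive
and pays for it. -/
theorem longestPath_circuit : h.circuit.LongestPathLE (3 * k) := by
  classical
  have key : ∀ (p : List (Fin L.length)) (v : Fin L.length), (v :: p).IsChain h.circuit.edge →
      L[v].rank + h.circuit.gatesOn p ≤ 3 * k := by
    intro p
    induction p with
    | nil => intro v _; simpa [Circuit.gatesOn] using h.rank_le _ (List.getElem_mem _)
    | cons w p ih =>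
      intro v hp
      rw [List.isChain_cons_cons] at hp
      have h1 := ih w hp.2
      have h2 := h.rank_lt_of_edge hp.1
      simp only [Circuit.gatesOn, List.countP_cons] at h1 ⊢
      by_cases hw : w ∈ h.circuit.gates
      · have := h2.2 hw
        simp [hw] at *
        omega
      · simp [hw] at *
        omega
  intro p hp
  rcases p with _ | ⟨v, p⟩
  · simp [Circuit.gatesOn]
  · have h1 := key p v hp
    have : h.circuit.gatesOn (v :: p) ≤ 3 * k := by
      simp only [Circuit.gatesOn, List.countP_cons] at h1 ⊢
      by_cases hv : v ∈ h.circuit.gates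
      · have := h.rank_pos hv
        simp [hv] at *
        omega
      · simp [hv] at *
        omega
    exact_mod_cast this

theorem describesVertex_circuit (v : Fin L.length) {c : ℕ → ℕ} (hc : L[v].desc.Encodes c) :
    DescribesVertex h.circuit v c := by
  have he : ∀ u, h.circuit.edge u v ↔ (u : ℕ) ∈ L[v].desc.refs := fun u => Iff.rfl
  have hs := h.consistent_get v
  rw [DescribesVertex, label_circuit]
  generalize L[v] = a at *
  unfold Consistent at hs
  split at hs <;> rename_i hd <;> rw [hd] at hc ⊢ <;> simp only [Desc.label] <;>
    simp only [he, hd, Desc.refs, Desc.Encodes] at *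
  · obtain ⟨-, ⟨hi, -⟩, -⟩ := hs
    simpa [hi] using hc
  · obtain ⟨-, -, j, hj, -⟩ := hs
    have hy := (List.getElem?_eq_some_iff.1 hj).1
    simp [hy, hc]
  · simp [hc]
  · simp [hc]
  · simp [hc]

end Built

/-! ### Checking a matrix and computing its cost -/

theorem runs_incMessage {s : State} {k N : ℕ} (h0 : s.reg 0 = k) (h4 : s.reg 4 = 0)
    (h5 : s.reg 5 = 1) (hm : ∀ i < k, s.mem i = bitAt N i) :
    Runs incMessage s (k * 7 + 3) (fun s' =>
      (s'.reg 16 = if 2 ^ k ∣ N + 1 then 1 else 0) ∧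
      (∀ i < k, s'.mem i = bitAt (N + 1) i) ∧ ∀ b, k ≤ b → s'.mem b = s.mem b) := by
  refine Runs.mono (T := 1 + (1 + (k * 7 + 1))) ?_ (by omega) (fun _ h => h)
  refine runs_seq <| runs_instr <| runs_seq <| runs_instr <|
    (runs_carry (a := 0) (n := k) (N := N) (by decide) ?_ ?_ ?_ ?_ ?_ ?_).mono le_rfl fun s' h => ?_
  · simp [Instr.run]
  · simpa [Instr.run] using h0
  · simp [Instr.run]
  · simpa [Instr.run] using h4
  · simpa [Instr.run] using h5
  · simpa [Instr.run] using hm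
  · exact ⟨h.1, by simpa using h.2.1, fun b hb => h.2.2 b (Or.inr (by omega))⟩

theorem runs_incMatrix {s : State} {k n N : ℕ} (h0 : s.reg 0 = k) (h3 : s.reg 3 = k + n)
    (h4 : s.reg 4 = 0) (h5 : s.reg 5 = 1) (hm : ∀ q < n, s.mem (k + q) = bitAt N q) :
    Runs incMatrix s (n * 7 + 3) (fun s' =>
      (s'.reg 16 = if 2 ^ n ∣ N + 1 then 1 else 0) ∧
      (∀ q < n, s'.mem (k + q) = bitAt (N + 1) q) ∧
      ∀ b, b < k ∨ k + n ≤ b → s'.mem b = s.mem b) := by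
  refine Runs.mono (T := 1 + (1 + (n * 7 + 1))) ?_ (by omega) (fun _ h => h)
  refine runs_seq <| runs_instr <| runs_seq <| runs_instr <|
    (runs_carry (a := k) (n := n) (N := N) (by decide) ?_ ?_ ?_ ?_ ?_ ?_).mono le_rfl fun s' h => h
  · simp [Instr.run, h0]
  · simpa [Instr.run] using h3
  · simp [Instr.run]
  · simpa [Instr.run] using h4
  · simpa [Instr.run] using h5
  · simpa [Instr.run] using hm

/-- All non-zero messages are encoded well. -/
def MatrixOk (k d r : ℕ) (g : ℕ → ℕ) : Prop :=
  ∀ x, 1 ≤ x → x < 2 ^ k → MessageOk k d r (bitAt x) g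

/-- Sets register 15 to 1 if all messages are encoded well, and to 0 otherwise. -/
def checkMatrix : Program :=
  .instr (.const 15 1) ;; incMessage ;; .loop (.eq 16 4) (checkMessage ;; incMessage)

theorem two_pow_dvd_succ_iff {k j : ℕ} (h : j < 2 ^ k) : 2 ^ k ∣ j + 1 ↔ j + 1 = 2 ^ k :=
  ⟨fun h' => le_antisymm h (Nat.le_of_dvd (Nat.succ_pos _) h'), fun h' => h' ▸ dvd_rfl⟩

theorem bitAt_two_pow {k i : ℕ} (h : i < k) : bitAt (2 ^ k) i = 0 := by
  obtain ⟨m, rfl⟩ := Nat.exists_eq_add_of_lt h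
  rw [bitAt, show i + m + 1 = i + (m + 1) by ring, pow_add, Nat.mul_div_cancel_left _ (by positivity),
    pow_succ]
  simp

theorem bitAt_zero (i : ℕ) : bitAt 0 i = 0 := by simp [bitAt]

open Classical in
-- The increment before the loop skips the zero message. The overflow after message `2 ^ k - 1` ends
-- the loop and leaves the message cells zero, ready for the next matrix.
theorem runs_checkMatrix {s : State} {k d r : ℕ} {g : ℕ → ℕ} (h0 : s.reg 0 = k)
    (h1 : s.reg 1 = d) (h2 : s.reg 2 = r) (h4 : s.reg 4 = 0) (h5 : s.reg 5 = 1) (hk : 1 ≤ k)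
    (hx : ∀ i < k, s.mem i = 0) (hg : ∀ q < r * k, s.mem (k + q) = g q) (hg2 : ∀ i, g i < 2) :
    Runs checkMatrix s
      (k * 7 + 5 + (2 ^ k - 1) * (k * 12 + r * (k * 9 + 7) + 15)) (fun s' =>
      (s'.reg 15 = if MatrixOk k d r g then 1 else 0) ∧
      (∀ i < k, s'.mem i = 0) ∧ ∀ b, k ≤ b → s'.mem b = s.mem b) := by
  have h2k : 2 ≤ 2 ^ k := by simpa using Nat.pow_le_pow_right (n := 2) (by norm_num) hk
  -- After `j` iterations the messages 1 to `j` have been checked and the memory holds message `j +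
  -- 1`.
  let I : ℕ → State → Prop := fun j s' =>
    (s'.reg 16 = if 2 ^ k ∣ j + 1 then 1 else 0) ∧ (∀ i < k, s'.mem i = bitAt (j + 1) i) ∧
    (∀ b, k ≤ b → s'.mem b = s.mem b) ∧
    (s'.reg 15 = if ∀ x, 1 ≤ x → x ≤ j → MessageOk k d r (bitAt x) g then 1 else 0) ∧
    ∀ a, checkMatrix.writes a = false → s'.reg a = s.reg a
  have key := fun s1 (hs1 : I 0 s1) => runs_loop (c := .eq 16 4) (p := checkMessage ;; incMessage)
    (T := k * 5 + r * (k * 9 + 7) + 11 + (k * 7 + 3)) (n := 2 ^ k - 1) I (s := s1) hs1 ?_ ?_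
  · refine Runs.mono (T := 1 + (k * 7 + 3 + ((2 ^ k - 1) *
      (k * 5 + r * (k * 9 + 7) + 11 + (k * 7 + 3) + 1) + 1))) ?_ ?_ (fun _ h => h)
    · refine runs_seq <| runs_instr <| runs_seq <| (runs_incMessage (k := k) (N := 0)
        ?_ ?_ ?_ ?_).conseq le_rfl fun s1 e1 hr1 _ => (key s1 ?_).mono le_rfl fun s2 hs2 => ?_
      · simpa [Instr.run] using h0
      · simpa [Instr.run] using h4
      · simpa [Instr.run] using h5
      · simpa [Instr.run, bitAt_zero] using hx
      · refine ⟨e1.1, e1.2.1, e1.2.2, ?_, fun a ha => ?_⟩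
        · rw [hr1 15 rfl, if_pos (fun x hx1 hx2 => absurd hx1 (by omega))]
          simp [Instr.run]
        · simp [checkMatrix, Program.writes, Instr.writes] at ha
          rw [hr1 a ha.2.1]
          simp [Instr.run, Function.update, ha.1]
      · obtain ⟨-, hb, hc, hd, -⟩ := hs2
        have e : 2 ^ k - 1 + 1 = 2 ^ k := by omega
        rw [e] at hb
        refine ⟨?_, fun i hi => by rw [hb i hi, bitAt_two_pow hi], hc⟩
        rw [hd]
        congr 1
        simp only [MatrixOk, eq_iff_iff]
        refine forall_congr' fun x => forall_congr' fun _ => ?_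
        rw [Nat.le_sub_one_iff_lt (by omega)]
    · rw [show k * 5 + r * (k * 9 + 7) + 11 + (k * 7 + 3) + 1 =
        k * 12 + r * (k * 9 + 7) + 15 by ring]
      omega
  · rintro j hj s' ⟨hc, hb, hm, ho, hf⟩
    have f0 := hf 0 rfl
    have f1 := hf 1 rfl
    have f2 := hf 2 rfl
    have f4 := hf 4 rfl
    have f5 := hf 5 rfl
    have hnd : ¬ 2 ^ k ∣ j + 1 := by rw [two_pow_dvd_succ_iff (by omega)]; omega
    refine ⟨by simp [Test.holds, hc, hnd, f4, h4], runs_seq ?_⟩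
    refine (runs_checkMessage (k := k) (d := d) (r := r) (x := bitAt (j + 1)) (g := g)
      (f0.trans h0) (f1.trans h1) (f2.trans h2) (f5.trans h5) hb
      (fun q hq => by rw [hm _ (by omega), hg q hq]) (bitAt_lt _) hg2).conseq le_rfl
      fun s1 e1 hr1 hm1 => ?_
    refine (runs_incMessage (k := k) (N := j + 1) ?_ ?_ ?_ ?_).conseq le_rfl fun s2 e2 hr2 _ => ?_
    · rw [hr1 0 rfl, f0, h0]
    · rw [hr1 4 rfl, f4, h4]
    · rw [hr1 5 rfl, f5, h5]
    · rw [hm1 rfl]; exact hb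
    · refine ⟨e2.1, e2.2.1, fun b hb => ?_, ?_, fun a ha => ?_⟩
      · rw [e2.2.2 b hb, hm1 rfl, hm b hb]
      · rw [hr2 15 rfl, e1, ho]
        by_cases hA : ∀ x, 1 ≤ x → x ≤ j + 1 → MessageOk k d r (bitAt x) g
        · rw [if_pos hA, if_pos (hA _ (by omega) le_rfl),
            if_pos fun x h h' => hA x h (by omega)]
        · rw [if_neg hA]
          split
          · rename_i hB
            rw [if_neg]
            intro hC
            refine hA fun x h h' => ?_
            rcases Nat.lt_or_ge j x with hjx | hjx
            · obtain rfl : x = j + 1 := by omega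
              exact hB
            · exact hC x h hjx
          · rfl
      · have ha' := ha
        simp only [checkMatrix, Program.writes, Bool.or_eq_false_iff] at ha'
        rw [hr2 a ha'.2.1, hr1 a ha'.2.2.1, hf a ha]
  · rintro s' ⟨hc, -, -, -, hf⟩
    have e : 2 ^ k - 1 + 1 = 2 ^ k := by omega
    simp [Test.holds, hc, e, hf 4 rfl, h4]

/-- Adds the weight of a column to register 19; sets register 12 if it is not zero. -/
def columnWeight : Program :=
  loopUp 7 0 (.instr (.load 11 9) ;;
    .branch (.eq 11 5) (.instr (.inc 19) ;; .instr (.const 12 1)) skip ;; .instr (.inc 9))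

theorem runs_columnWeight {s : State} {k q w : ℕ} {g : ℕ → ℕ} (h0 : s.reg 0 = k)
    (h5 : s.reg 5 = 1) (h7 : s.reg 7 = 0) (h9 : s.reg 9 = q) (h12 : s.reg 12 = 0)
    (h19 : s.reg 19 = w) (hg : ∀ i < k, s.mem (q + i) = g i) (hg2 : ∀ i, g i < 2) :
    Runs columnWeight s (k * 7 + 1) (fun s' =>
      s'.reg 19 = w + ∑ i ∈ Finset.range k, g i ∧
      (s'.reg 12 = if ∃ i < k, g i = 1 then 1 else 0) ∧ s'.reg 9 = q + k) := by
  refine runs_loopUp (a := 0) (T := 5) (fun j s' =>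
      s'.reg 19 = w + ∑ i ∈ Finset.range j, g i ∧
      (s'.reg 12 = if ∃ i < j, g i = 1 then 1 else 0) ∧ s'.reg 9 = q + j)
    rfl rfl (by decide) h7 (by simpa using h0) (by simp [h12, h9, h19]) ?_
  rintro j hj s' ⟨hp, ho, hq⟩ hi hf hm
  have h5' : s'.reg 5 = 1 := (hf 5 rfl).trans h5
  have hm' := hm rfl
  have hgj := hg j hj
  have hgj2 := hg2 j
  refine Runs.mono (T := ?T) ?h ?hT (fun _ h => h)
  case h =>
    refine runs_seq <| runs_instr <| runs_seq <| runs_branch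
      (fun h => runs_seq <| runs_instr <| runs_instr <| runs_instr ?_)
      (fun h => runs_instr <| runs_instr ?_)
    all_goals
      simp only [Test.holds, Instr.run, Function.update_apply] at *
      simp [h5', hq, hm', hgj] at h
    · have : ∃ i < j + 1, g i = 1 := ⟨j, by omega, h⟩
      rw [if_pos this, Finset.sum_range_succ]
      simp [hp, hq, h, add_assoc]
    · have h' : g j = 0 := by omega
      have : (∃ i < j + 1, g i = 1) ↔ ∃ i < j, g i = 1 := by
        constructor
        · rintro ⟨i, hi, hgi⟩
          have : i ≠ j := by rintro rfl; omega
          exact ⟨i, by omega, hgi⟩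
        · rintro ⟨i, hi, hgi⟩
          exact ⟨i, by omega, hgi⟩
      rw [Finset.sum_range_succ]
      simp only [this]
      simp [hp, hq, h', ho, add_assoc]
  case hT => simp

/-- The weight of the matrix `g`. -/
def matrixWeight (k r : ℕ) (g : ℕ → ℕ) : ℕ :=
  ∑ j ∈ Finset.range r, ∑ i ∈ Finset.range k, g (j * k + i)

/-- The columns of the matrix `g` that are not zero. -/
def nonzeroColumns (k r : ℕ) (g : ℕ → ℕ) : List ℕ :=
  (List.range r).filter fun j => ∃ i < k, g (j * k + i) = 1

theorem nonzeroColumns_succ (k r : ℕ) (g : ℕ → ℕ) :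
    nonzeroColumns k (r + 1) g =
      nonzeroColumns k r g ++ if ∃ i < k, g (r * k + i) = 1 then [r] else [] := by
  rw [nonzeroColumns, List.range_succ, List.filter_append, List.filter_singleton]
  simp [nonzeroColumns]

/-- Computes the weight and the number of non-zero columns in the registers 19 and 20. -/
def matrixCost : Program :=
  .instr (.const 19 0) ;; .instr (.const 20 0) ;; .instr (.copy 9 0) ;; .instr (.const 8 0) ;;
  loopUp 8 2 (.instr (.const 12 0) ;; .instr (.const 7 0) ;; columnWeight ;;
    .branch (.eq 12 5) (.instr (.inc 20)) skip)

theorem runs_matrixCost {s : State} {k r : ℕ} {g : ℕ → ℕ} (h0 : s.reg 0 = k) (h2 : s.reg 2 = r)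
    (h5 : s.reg 5 = 1) (hg : ∀ q < r * k, s.mem (k + q) = g q) (hg2 : ∀ i, g i < 2) :
    Runs matrixCost s (r * (k * 7 + 7) + 5) (fun s' =>
      s'.reg 19 = matrixWeight k r g ∧ s'.reg 20 = (nonzeroColumns k r g).length) := by
  refine Runs.mono (T := 1 + (1 + (1 + (1 + (r * (k * 7 + 5 + 2) + 1))))) ?_ (by
    rw [show k * 7 + 5 + 2 = k * 7 + 7 by ring]; omega) (fun _ h => h)
  refine runs_seq <| runs_instr <| runs_seq <| runs_instr <| runs_seq <| runs_instr <|
    runs_seq <| runs_instr ?_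
  refine (runs_loopUp (a := 0) (T := k * 7 + 5) (fun j s' =>
      s'.reg 19 = matrixWeight k j g ∧ s'.reg 20 = (nonzeroColumns k j g).length ∧
      s'.reg 9 = k + j * k)
    rfl rfl (by decide) (by simp [Instr.run]) (by simpa [Instr.run] using h2)
      (by simp [Instr.run, h0, matrixWeight, nonzeroColumns]) ?_).mono le_rfl
    (fun s' h => ⟨h.1, h.2.1⟩)
  rintro j hj s' ⟨hp, ho, hq⟩ hi hf hm
  have h5' : s'.reg 5 = 1 := (hf 5 rfl).trans (by simpa [Instr.run] using h5)
  have h0' : s'.reg 0 = k := (hf 0 rfl).trans (by simpa [Instr.run] using h0)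
  have hm' : s'.mem = s.mem := hm rfl
  refine Runs.mono (T := ?T) ?h ?hT (fun _ h => h)
  case h =>
    refine runs_seq <| runs_instr <| runs_seq <| runs_instr <| runs_seq <| (runs_columnWeight
      (k := k) (q := k + j * k) (g := fun i => g (j * k + i)) ?_ ?_ ?_ ?_ ?_ rfl ?_
      (fun _ => hg2 _)).conseq
      le_rfl fun s'' h hreg _ => runs_branch (fun h' => runs_instr ?_) (fun h' => runs_instr ?_)
    · simpa [Instr.run] using h0'
    · simpa [Instr.run] using h5'
    · simp [Instr.run]
    · simpa [Instr.run] using hq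
    · simp [Instr.run]
    · intro i hi'
      simp only [Instr.run, hm', add_assoc]
      exact hg _ (column_index_lt hi' hj)
    all_goals
      have e5 := hreg 5 rfl
      have e20 := hreg 20 rfl
      simp [Instr.run, h5', hp, ho] at h e5 e20
      simp only [Test.holds, e5, h.2.1] at h'
      rw [nonzeroColumns_succ, matrixWeight, Finset.sum_range_succ, ← matrixWeight]
      by_cases hA : ∃ i < k, g (j * k + i) = 1
      · simp [Instr.run, hA, h, e20] at h' ⊢ <;> ring
      · simp [Instr.run, hA, h, e20] at h' ⊢ <;> ring
  case hT => simp; omega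

/-! ### Writing the circuit of a matrix -/

/-- The list `D` is described in the memory from `base` on; the registers 24 and 25 hold its length
and the address of the next free cell. -/
structure Emitted (s : State) (base : ℕ) (D : List Desc) : Prop where
  length_eq : s.reg 24 = D.length
  next_eq : s.reg 25 = base + 3 * D.length
  encodes : ∀ (v : ℕ) (δ : Desc), D[v]? = some δ → δ.Encodes fun j => s.mem (base + 3 * v + j)

theorem Emitted.congr {s s' : State} {base : ℕ} {D : List Desc} (h : Emitted s base D)
    (h24 : s'.reg 24 = s.reg 24) (h25 : s'.reg 25 = s.reg 25)
    (hm : ∀ b, base ≤ b → s'.mem b = s.mem b) : Emitted s' base D where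
  length_eq := h24.trans h.length_eq
  next_eq := h25.trans h.next_eq
  encodes v δ hv := by
    have : (fun j => s'.mem (base + 3 * v + j)) = fun j => s.mem (base + 3 * v + j) :=
      funext fun j => hm _ (by omega)
    rw [this]
    exact h.encodes v δ hv

theorem Desc.Encodes.congr {δ : Desc} {c c' : ℕ → ℕ} (h : δ.Encodes c) (h0 : c' 0 = c 0)
    (h1 : c' 1 = c 1) (h2 : c' 2 = c 2) : δ.Encodes c' := by
  cases δ <;> simpa [Desc.Encodes, h0, h1, h2] using h

/-- Appends the description of a vertex. -/
def emitVertex (c a b : ℕ) : Program :=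
  .instr (.const 29 c) ;; .instr (.store 25 29) ;; .instr (.inc 25) ;; .instr (.store 25 a) ;;
  .instr (.inc 25) ;; .instr (.store 25 b) ;; .instr (.inc 25) ;; .instr (.inc 24)

/-- The cells below `base` hold the message and the matrix, which must survive the writing of the
circuit. -/
theorem runs_emitVertex {s : State} {base c a b : ℕ} {D : List Desc} {δ : Desc}
    (h : Emitted s base D) (ha : a ≠ 24 ∧ a ≠ 25 ∧ a ≠ 29) (hb : b ≠ 24 ∧ b ≠ 25 ∧ b ≠ 29)
    (hδ : δ.Encodes fun j => if j = 0 then c else if j = 1 then s.reg a else s.reg b) :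
    Runs (emitVertex c a b) s 8 (fun s' =>
      Emitted s' base (D ++ [δ]) ∧ ∀ i < base, s'.mem i = s.mem i) := by
  refine runs_seq (T := 1) (T' := 7) <| runs_instr <| runs_seq (T := 1) (T' := 6) <| runs_instr <|
    runs_seq (T := 1) (T' := 5) <| runs_instr <| runs_seq (T := 1) (T' := 4) <| runs_instr <|
    runs_seq (T := 1) (T' := 3) <| runs_instr <| runs_seq (T := 1) (T' := 2) <| runs_instr <|
    runs_seq (T := 1) (T' := 1) <| runs_instr <| runs_instr ?_
  have h25 := h.next_eq
  have h24 := h.length_eq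
  refine ⟨⟨by simp [Instr.run, h24], by simp [Instr.run, h25]; ring, ?_⟩, ?_⟩
  · intro v ε hv
    have hm : ∀ i, i < base + 3 * D.length → ((Instr.inc 24).run ((Instr.inc 25).run
        ((Instr.store 25 b).run ((Instr.inc 25).run ((Instr.store 25 a).run ((Instr.inc 25).run
        ((Instr.store 25 29).run ((Instr.const 29 c).run s)))))))).mem i = s.mem i := by
      intro i hi
      have e1 : i ≠ base + 3 * D.length := by omega
      have e2 : i ≠ base + 3 * D.length + 1 := by omega
      have e3 : i ≠ base + 3 * D.length + 1 + 1 := by omega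
      simp [Instr.run, h25, Function.update_apply, e1, e2, e3]
    rcases lt_or_ge v D.length with hvl | hvl
    · rw [List.getElem?_append_left hvl] at hv
      refine (h.encodes v ε hv).congr ?_ ?_ ?_ <;> exact hm _ (by omega)
    · have := (List.getElem?_eq_some_iff.1 hv).1
      obtain rfl : v = D.length := by simp at this; omega
      simp at hv
      subst hv
      refine hδ.congr ?_ ?_ ?_
      · simp [Instr.run, h25, Function.update_apply]
        omega
      · simp [Instr.run, h25, Function.update_apply, ha]
      · simp [Instr.run, h25, Function.update_apply, hb]
  · intro i hi
    have e1 : i ≠ base + 3 * D.length := by omega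
    have e2 : i ≠ base + 3 * D.length + 1 := by omega
    have e3 : i ≠ base + 3 * D.length + 1 + 1 := by omega
    simp [Instr.run, h25, Function.update_apply, e1, e2, e3]

/-- Appends the input vertices. -/
def emitInputs : Program := loopUp 7 0 (emitVertex 0 7 7)

theorem runs_emitInputs {s : State} {base k : ℕ} (h0 : s.reg 0 = k) (h7 : s.reg 7 = 0)
    (h : Emitted s base []) :
    Runs emitInputs s (k * 10 + 1) (fun s' =>
      Emitted s' base ((List.range k).map Desc.input) ∧ ∀ i < base, s'.mem i = s.mem i) := by
  refine runs_loopUp (a := 0) (T := 8) (fun j s' =>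
    Emitted s' base ((List.range j).map Desc.input) ∧ ∀ i < base, s'.mem i = s.mem i)
    rfl rfl (by decide) h7 (by simpa using h0) ⟨by simpa using h, fun _ _ => rfl⟩ ?_
  rintro j hj s' ⟨he, hm⟩ hi hf -
  refine (runs_emitVertex (δ := .input j) he (by decide) (by decide)
    (by simp [Desc.Encodes, hi])).mono le_rfl fun s'' hs => ⟨?_, fun i hi => ?_⟩
  · rw [List.range_succ, List.map_append]
    exact hs.1.congr (by simp [Instr.run]) (by simp [Instr.run]) (fun _ _ => rfl)
  · rw [← hm i hi, ← hs.2 i hi]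
    rfl

/-- Adds the input in register 7 to the signal of the vertex in register 26. -/
def xorRow : Program :=
  .instr (.copy 27 24) ;; emitVertex 3 26 7 ;; emitVertex 2 27 27 ;; emitVertex 4 26 7 ;;
  .instr (.inc 27) ;; .instr (.copy 28 27) ;; .instr (.inc 28) ;; emitVertex 3 27 28 ;;
  .instr (.copy 26 24) ;; .instr (.dec 26)

theorem runs_xorRow {s : State} {base acc n : ℕ} {D : List Desc} (h : Emitted s base D)
    (h26 : s.reg 26 = acc) (h7 : s.reg 7 = n) :
    Runs xorRow s 38 (fun s' => Emitted s' base (D ++ xorGates acc n D.length) ∧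
      s'.reg 26 = D.length + 3 ∧ ∀ i < base, s'.mem i = s.mem i) := by
  have h24 := h.length_eq
  -- Register 27 keeps the position of the first new gate, from which the references to the new
  -- gates are formed.
  have h' : Emitted ((Instr.copy 27 24).run s) base D :=
    h.congr (by simp [Instr.run]) (by simp [Instr.run]) (fun _ _ => rfl)
  refine runs_seq (T := 1) (T' := 37) <| runs_instr <| runs_seq (T := 8) (T' := 29) <|
    (runs_emitVertex (δ := .and acc n) h' (by decide) (by decide)
      (by simp [Desc.Encodes, Instr.run, h26, h7])).conseq le_rfl fun s1 e1 r1 _ => ?_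
  refine runs_seq (T := 8) (T' := 21) <| (runs_emitVertex (δ := .not D.length) e1.1 (by decide)
    (by decide) (by simp [Desc.Encodes, r1 27 rfl, Instr.run, h24])).conseq le_rfl
    fun s2 e2 r2 _ => ?_
  refine runs_seq (T := 8) (T' := 13) <| (runs_emitVertex (δ := .or acc n) e2.1 (by decide)
    (by decide) (by simp [Desc.Encodes, r2 26 rfl, r1 26 rfl, r2 7 rfl, r1 7 rfl, Instr.run, h26,
      h7])).conseq le_rfl fun s3 e3 r3 _ => ?_
  refine runs_seq (T := 1) (T' := 12) <| runs_instr <| runs_seq (T := 1) (T' := 11) <| runs_instr <|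
    runs_seq (T := 1) (T' := 10) <| runs_instr ?_
  have h3 : Emitted ((Instr.inc 28).run ((Instr.copy 28 27).run ((Instr.inc 27).run s3))) base
      (D ++ [.and acc n] ++ [.not D.length] ++ [.or acc n]) :=
    e3.1.congr (by simp [Instr.run]) (by simp [Instr.run]) (fun _ _ => rfl)
  refine runs_seq (T := 8) (T' := 2) <| (runs_emitVertex (δ := .and (D.length + 1) (D.length + 2))
    h3 (by decide) (by decide) (by simp [Desc.Encodes, Instr.run, r3 27 rfl, r2 27 rfl, r1 27 rfl,
      h24])).conseq le_rfl fun s4 e4 r4 _ => ?_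
  refine runs_seq (T := 1) (T' := 1) <| runs_instr <| runs_instr ⟨?_, ?_, fun i hi => ?_⟩
  · refine Emitted.congr (s := s4) ?_ (by simp [Instr.run]) (by simp [Instr.run]) (fun _ _ => rfl)
    simpa [xorGates] using e4.1
  · simp [Instr.run, e4.1.length_eq]
  · have q1 := e1.2 i hi
    have q2 := e2.2 i hi
    have q3 := e3.2 i hi
    have q4 := e4.2 i hi
    simp only [Instr.run] at q1 q4 ⊢
    rw [q4, q3, q2, q1]

/-- Appends the gates of the column at the address in register 9. Register 12 is set to 1 and
register 26 to the vertex of the sum, if the column is not zero. -/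
def emitColumn : Program :=
  loopUp 7 0 (.instr (.load 11 9) ;;
    .branch (.eq 11 5)
      (.branch (.eq 12 5) xorRow (.instr (.copy 26 7) ;; .instr (.const 12 1))) skip ;;
    .instr (.inc 9))

theorem Built.mono {k : ℕ} {g : ℕ → ℕ} {cols : List ℕ} {o o' : ℕ} {L : List (Ann k)}
    (h : Built g cols o L) (ho : o ≤ o') : Built g cols o' L :=
  { h with owner_lt := fun a ha y hy => (h.owner_lt a ha y hy).trans_le ho }

/-- Register 12 separates two phases: before the first entry of the column nothing is appended, and
from then on register 26 points to the partial sum. Each row appends at most four vertices. -/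
theorem runs_emitColumn {s : State} {base k r j : ℕ} {g : ℕ → ℕ} {cols : List ℕ} {L : List (Ann k)}
    (h0 : s.reg 0 = k) (h5 : s.reg 5 = 1) (h7 : s.reg 7 = 0) (h9 : s.reg 9 = k + j * k)
    (h12 : s.reg 12 = 0) (hj : j < r) (hbase : base = k + r * k)
    (hg : ∀ q < r * k, s.mem (k + q) = g q) (hg2 : ∀ i, g i < 2)
    (hE : Emitted s base (L.map Ann.desc)) (hB : Built g cols cols.length L) :
    Runs emitColumn s (k * 44 + 1) (fun s' => ∃ L' : List (Ann k),
      Emitted s' base (L'.map Ann.desc) ∧ L'.length ≤ L.length + 4 * k ∧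
      (∀ i < base, s'.mem i = s.mem i) ∧ s'.reg 9 = k + j * k + k ∧
      ((s'.reg 12 = 0 ∧ (∀ i < k, g (j * k + i) = 0) ∧ Built g cols cols.length L') ∨
        (s'.reg 12 = 1 ∧ (∃ i < k, g (j * k + i) = 1) ∧ Built g cols (cols.length + 1) L' ∧
          ∃ b, Partial g cols j k L' (s'.reg 26) b))) := by
  refine runs_loopUp (a := 0) (T := 42) (fun n s' => ∃ L' : List (Ann k),
      Emitted s' base (L'.map Ann.desc) ∧ L'.length ≤ L.length + 4 * n ∧
      (∀ i < base, s'.mem i = s.mem i) ∧ s'.reg 9 = k + j * k + n ∧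
      ((s'.reg 12 = 0 ∧ (∀ i < n, g (j * k + i) = 0) ∧ Built g cols cols.length L') ∨
        (s'.reg 12 = 1 ∧ (∃ i < n, g (j * k + i) = 1) ∧ Built g cols (cols.length + 1) L' ∧
          ∃ b, Partial g cols j n L' (s'.reg 26) b)))
    rfl rfl (by decide) h7 (by simpa using h0)
    ⟨L, hE, by omega, fun _ _ => rfl, by simpa using h9, Or.inl ⟨h12, by simp, hB⟩⟩ ?_
  rintro n hn s' ⟨L', hE', hL', hm, hq, hcase⟩ hi hf -
  have h5' : s'.reg 5 = 1 := (hf 5 rfl).trans h5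
  have hlt := column_index_lt hn hj
  have hv : s'.mem (s'.reg 9) = g (j * k + n) := by
    rw [hq, hm _ (by omega), add_assoc, hg _ hlt]
  have hgn := hg2 (j * k + n)
  simp only [zero_add] at hi
  have hE1 : Emitted ((Instr.load 11 9).run s') base (L'.map Ann.desc) :=
    hE'.congr (by simp [Instr.run]) (by simp [Instr.run]) (fun _ _ => rfl)
  refine runs_seq (T := 1) (T' := 41) <| runs_instr <| runs_seq (T := 40) (T' := 1) ?_
  refine runs_branch (T := 39) (T' := 39) (fun h => ?_) (fun h => ?_)
  · have hg1 : g (j * k + n) = 1 := by simpa [Test.holds, Instr.run, hv, h5'] using h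
    refine runs_branch (T := 38) (T' := 38) (fun h' => ?_) (fun h' => ?_)
    · have h12' : s'.reg 12 = 1 := by simpa [Test.holds, Instr.run, h5'] using h'
      rcases hcase with hc | ⟨-, hex, hB', b, hP⟩
      · omega
      · refine (runs_xorRow hE1 rfl rfl).conseq le_rfl fun s2 e2 r2 _ => runs_instr ?_
        obtain ⟨L2, b2, hd2, hB2, hP2⟩ := hB'.xor_row (acc := s'.reg 26) hP hn hg1
        have hlen : L2.length = L'.length + 4 := by
          simpa [xorGates] using congrArg List.length hd2
        refine ⟨L2, Emitted.congr (s := s2) ?_ (by simp [Instr.run]) (by simp [Instr.run])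
          (fun _ _ => rfl), by omega, fun i hi => (e2.2.2 i hi).trans (hm i hi), ?_, Or.inr
          ⟨?_, ⟨n, by omega, hg1⟩, hB2, b2, ?_⟩⟩
        · rw [hd2]
          have := e2.1
          simpa [Instr.run, hi] using this
        · simp [Instr.run, r2 9 rfl, hq, add_assoc]
        · simp [Instr.run, r2 12 rfl, h12']
        · have e := e2.2.1
          simp only [List.length_map] at e
          simpa [Instr.run, e] using hP2
    · rcases hcase with ⟨-, hz, hB'⟩ | hc
      · refine Runs.mono (T := 1 + 1) (runs_seq <| runs_instr <| runs_instr <| runs_instr ?_)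
          (by norm_num) (fun _ h => h)
        obtain ⟨b, hP⟩ := hB'.first_row hn hg1 hz
        refine ⟨L', hE1.congr (by simp [Instr.run]) (by simp [Instr.run]) (fun _ _ => rfl),
          by omega, hm, by simp [Instr.run, hq, add_assoc], Or.inr ⟨by simp [Instr.run],
          ⟨n, by omega, hg1⟩, hB'.mono (by omega), b, by simpa [Instr.run, hi] using hP⟩⟩
      · simp [Test.holds, Instr.run, h5', hc.1] at h'
  · have hg0 : g (j * k + n) = 0 := by
      have : g (j * k + n) ≠ 1 := by simpa [Test.holds, Instr.run, hv, h5'] using h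
      omega
    refine Runs.mono (T := 1) (runs_instr <| runs_instr ?_) (by norm_num) (fun _ h => h)
    refine ⟨L', hE1.congr (by simp [Instr.run]) (by simp [Instr.run]) (fun _ _ => rfl),
      by omega, hm, by simp [Instr.run, hq, add_assoc], ?_⟩
    rcases hcase with ⟨h12', hz, hB'⟩ | ⟨h12', ⟨i, hi1, hi2⟩, hB', b, hP⟩
    · refine Or.inl ⟨by simpa [Instr.run] using h12', fun i hi => ?_, hB'⟩
      rcases Nat.lt_succ_iff_lt_or_eq.1 hi with hi | rfl
      · exact hz i hi
      · exact hg0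
    · exact Or.inr ⟨by simpa [Instr.run] using h12', ⟨i, by omega, hi2⟩, hB', b,
        by simpa [Instr.run] using hP.skip_row hn hg0⟩

/-- Writes the circuit of the matrix; register 23 is the number of outputs. -/
def emitMatrix : Program :=
  .instr (.const 23 0) ;; .instr (.const 24 0) ;; .instr (.copy 25 3) ;; .instr (.const 7 0) ;;
  emitInputs ;; .instr (.copy 9 0) ;; .instr (.const 8 0) ;;
  loopUp 8 2 (.instr (.const 12 0) ;; .instr (.const 7 0) ;; emitColumn ;;
    .branch (.eq 12 5) (emitVertex 1 23 26 ;; .instr (.inc 23)) skip)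

/-- The vertex count consists of `k` inputs and, for each column, at most `4 * k` gates and one
output. Zero columns produce no output, so the outputs are numbered by `nonzeroColumns`. -/
theorem runs_emitMatrix {s : State} {base k r : ℕ} {g : ℕ → ℕ}
    (h0 : s.reg 0 = k) (h2 : s.reg 2 = r) (h3 : s.reg 3 = base) (h5 : s.reg 5 = 1)
    (hbase : base = k + r * k)
    (hg : ∀ q < r * k, s.mem (k + q) = g q) (hg2 : ∀ i, g i < 2) :
    Runs emitMatrix s (k * 10 + r * (k * 44 + 15) + 8) (fun s' => ∃ L : List (Ann k),
      Emitted s' base (L.map Ann.desc) ∧ L.length ≤ k + r * (4 * k + 1) ∧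
      (∀ i < base, s'.mem i = s.mem i) ∧ s'.reg 23 = (nonzeroColumns k r g).length ∧
      Built g (nonzeroColumns k r g) (nonzeroColumns k r g).length L) := by
  refine Runs.mono (T := 1 + (1 + (1 + (1 + ((k * 10 + 1) + (1 + (1 + (r * (k * 44 + 13 + 2) + 1)))))
    ))) ?_ (by rw [show k * 44 + 13 + 2 = k * 44 + 15 by ring]; omega) (fun _ h => h)
  refine runs_seq <| runs_instr <| runs_seq <| runs_instr <| runs_seq <| runs_instr <|
    runs_seq <| runs_instr <| runs_seq <| (runs_emitInputs (base := base) (k := k) ?_ ?_ ?_).conseq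
    le_rfl fun s1 e1 r1 _ => runs_seq <| runs_instr <| runs_seq <| runs_instr ?_
  · simpa [Instr.run] using h0
  · simp [Instr.run]
  · exact ⟨by simp [Instr.run], by simp [Instr.run, h3], by simp⟩
  refine (runs_loopUp (a := 0) (T := k * 44 + 13) (fun j s' => ∃ L : List (Ann k),
      Emitted s' base (L.map Ann.desc) ∧ L.length ≤ k + j * (4 * k + 1) ∧
      (∀ i < base, s'.mem i = s.mem i) ∧ s'.reg 23 = (nonzeroColumns k j g).length ∧
      s'.reg 9 = k + j * k ∧
      Built g (nonzeroColumns k j g) (nonzeroColumns k j g).length L)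
    rfl rfl (by decide) (by simp [Instr.run]) (by simpa [Instr.run, r1 2 rfl] using h2)
      ⟨inputList k, ?_, by simp [inputList], fun i hi => ?_, ?_, ?_, built_inputList k g⟩
      ?_).mono le_rfl ?_
  · rw [inputList_map_desc]
    exact e1.1.congr (by simp [Instr.run]) (by simp [Instr.run]) (fun _ _ => rfl)
  · simpa [Instr.run] using e1.2 i hi
  · simp [Instr.run, r1 23 rfl, nonzeroColumns]
  · simp [Instr.run, r1 0 rfl, h0]
  · rintro j hj s' ⟨L, hE, hL, hm, h23, h9, hB⟩ hi hf -
    have h5' : s'.reg 5 = 1 := (hf 5 rfl).trans (by simpa [Instr.run, r1 5 rfl] using h5)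
    have h0' : s'.reg 0 = k := (hf 0 rfl).trans (by simpa [Instr.run, r1 0 rfl] using h0)
    refine Runs.mono (T := 1 + (1 + (k * 44 + 1 + (9 + 1)))) ?_ (by omega) (fun _ h => h)
    refine runs_seq <| runs_instr <| runs_seq <| runs_instr <| runs_seq <|
      (runs_emitColumn (base := base) (k := k) (r := r) (j := j) (g := g)
        (cols := nonzeroColumns k j g) (L := L) ?_ ?_ ?_ ?_ ?_ hj hbase ?_ hg2 ?_ hB).conseq
      le_rfl fun s2 e2 r2 _ => ?_
    · simpa [Instr.run] using h0'
    · simpa [Instr.run] using h5'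
    · simp [Instr.run]
    · simpa [Instr.run] using h9
    · simp [Instr.run]
    · intro q hq
      simp only [Instr.run]
      rw [hm _ (by omega), hg q hq]
    · exact hE.congr (by simp [Instr.run]) (by simp [Instr.run]) (fun _ _ => rfl)
    obtain ⟨L', hE', hL', hm', h9', hcase⟩ := e2
    have h5'' : s2.reg 5 = 1 := (r2 5 rfl).trans (by simpa [Instr.run] using h5')
    have h23' : s2.reg 23 = (nonzeroColumns k j g).length :=
      (r2 23 rfl).trans (by simpa [Instr.run] using h23)
    have hmul : (j + 1) * (4 * k + 1) = j * (4 * k + 1) + 4 * k + 1 := by ring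
    have h9'' : k + j * k + k = k + (j + 1) * k := by ring
    refine runs_branch (T := 9) (T' := 9) (fun h => ?_) (fun h => ?_)
    · rcases hcase with hc | ⟨-, hex, hB', b, hP⟩
      · simp [Test.holds, hc.1, h5''] at h
      · rw [nonzeroColumns_succ, if_pos hex]
        refine runs_seq (T := 8) (T' := 1) <| (runs_emitVertex
          (δ := .output (nonzeroColumns k j g).length (s2.reg 26)) hE' (by decide) (by decide)
          (by simp [Desc.Encodes, h23'])).conseq le_rfl fun s3 e3 r3 _ => runs_instr ?_
        -- The vertex of the finished partial sum, possibly an input, feeds the new output.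
        have hB2 := hB'.append_output hP.get hP.val hP.sup hP.owner hP.no_output
        refine ⟨_, ?_, ?_, fun i hi => ?_, ?_, ?_, by simpa using hB2⟩
        · rw [List.map_append]
          exact e3.1.congr (by simp [Instr.run]) (by simp [Instr.run]) (fun _ _ => rfl)
        · simp only [List.length_append, List.length_singleton]
          omega
        · have q1 := e3.2 i hi
          have q2 := hm' i hi
          have q3 := hm i hi
          simp only [Instr.run] at q2 ⊢
          rw [q1, q2, q3]
        · simp [Instr.run, r3 23 rfl, h23']
        · simpa [Instr.run, r3 9 rfl, h9'] using h9''
    · rcases hcase with ⟨-, hz, hB'⟩ | hc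
      · have hex : ¬ ∃ i < k, g (j * k + i) = 1 := by
          rintro ⟨i, hi, hgi⟩
          have := hz i hi
          omega
        rw [nonzeroColumns_succ, if_neg hex, List.append_nil]
        refine Runs.mono (T := 1) (runs_instr ?_) (by norm_num) (fun _ h => h)
        refine ⟨L', hE'.congr (by simp [Instr.run]) (by simp [Instr.run]) (fun _ _ => rfl),
          by omega, fun i hi => ?_, by simp [Instr.run, h23'],
          by simpa [Instr.run, h9'] using h9'', hB'⟩
        have q2 := hm' i hi
        have q3 := hm i hi
        simp only [Instr.run] at q2 ⊢
        rw [q2, q3]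
      · simp [Test.holds, hc.1, h5''] at h
  · rintro s' ⟨L, hE, hL, hm, h23, -, hB⟩
    exact ⟨L, hE, hL, fun i hi => hm i hi, h23, hB⟩

/-! ### Codes -/

/-- All non-zero messages have non-zero parity bits and are encoded as words of weight at least
`d`. -/
def Encodes {k : ℕ} {κ : Type} [Fintype κ] (d : ℕ) (G : Matrix (Fin k) κ (ZMod 2)) : Prop :=
  ∀ x, x ≠ 0 → 0 < hammingNorm (Matrix.vecMul x G) ∧
    d ≤ hammingNorm x + hammingNorm (Matrix.vecMul x G)

theorem hammingDist_append {k m : ℕ} (a b : Fin k → ZMod 2) (a' b' : Fin m → ZMod 2) :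
    hammingDist (Fin.append a a') (Fin.append b b') = hammingDist a b + hammingDist a' b' := by
  simp only [hammingDist, Finset.card_filter, Fin.sum_univ_add, Fin.append_left, Fin.append_right]

theorem hammingDist_encode {k m : ℕ} (G : Matrix (Fin k) (Fin m) (ZMod 2)) (x y : Fin k → ZMod 2) :
    hammingDist (encode G x) (encode G y) =
      hammingNorm (x - y) + hammingNorm (Matrix.vecMul (x - y) G) := by
  rw [encode, encode, hammingDist_append, hammingDist_comm, hammingDist_eq_hammingNorm,
    hammingDist_comm, hammingDist_eq_hammingNorm, Matrix.sub_vecMul, neg_add_eq_sub, neg_add_eq_sub]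

/-- By linearity the distance of two code words is the weight of the code word of the difference,
and injectivity means that only the zero message has zero parity. -/
theorem encodes_iff {k m d : ℕ} (hk : 1 ≤ k) (G : Matrix (Fin k) (Fin m) (ZMod 2)) :
    Encodes d G ↔ Function.Injective (fun x : Fin k → ZMod 2 => Matrix.vecMul x G) ∧
      d ≤ minDist (Set.range (encode G)) := by
  have hinj : Function.Injective (encode G) := fun x y hxy => funext fun i => by
    simpa [encode] using congrFun hxy (Fin.castAdd m i)
  -- As `k ≥ 1` there are two different code words; on an empty set of distances `sInf` would take
  -- the default value 0.
  have hne : {e | ∃ x ∈ Set.range (encode G), ∃ y ∈ Set.range (encode G),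
      x ≠ y ∧ e = hammingDist x y}.Nonempty := by
    have : NeZero k := ⟨by omega⟩
    exact ⟨_, _, ⟨0, rfl⟩, _, ⟨1, rfl⟩, fun h => zero_ne_one (hinj h), rfl⟩
  constructor
  · intro h
    refine ⟨fun x y hxy => ?_, ?_⟩
    · by_contra hne
      have := (h (x - y) (sub_ne_zero.2 hne)).1
      rw [hammingNorm_pos_iff, Matrix.sub_vecMul] at this
      exact this (sub_eq_zero.2 hxy)
    · refine le_csInf hne ?_
      rintro e ⟨_, ⟨x, rfl⟩, _, ⟨y, rfl⟩, hxy, rfl⟩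
      rw [hammingDist_encode]
      exact (h (x - y) (sub_ne_zero.2 fun h => hxy (h ▸ rfl))).2
  · rintro ⟨h1, h2⟩ x hx
    refine ⟨?_, h2.trans (Nat.sInf_le ⟨_, ⟨x, rfl⟩, _, ⟨0, rfl⟩, hinj.ne hx, ?_⟩)⟩
    · rw [hammingNorm_pos_iff]
      intro h
      exact hx (h1 (by simpa using h))
    · rw [hammingDist_encode, sub_zero]

/-- Zero columns contribute to no parity weight. This is used both to pad the matrix of a feasible
circuit to `r` columns and to drop the zero columns of the matrix found. -/
theorem encodes_submatrix_iff {k d : ℕ} {κ ι : Type} [Fintype κ] [Fintype ι]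
    (G : Matrix (Fin k) κ (ZMod 2)) {e : ι → κ} (he : Function.Injective e)
    (h0 : ∀ j, j ∉ Set.range e → ∀ i, G i j = 0) : Encodes d (G.submatrix id e) ↔ Encodes d G := by
  have key : ∀ x, hammingNorm (Matrix.vecMul x (G.submatrix id e)) =
      hammingNorm (Matrix.vecMul x G) := by
    intro x
    rw [hammingNorm, hammingNorm]
    refine Finset.card_bij (fun a _ => e a) ?_ (fun a _ b _ h => he h) ?_
    · intro a ha
      exact Finset.mem_filter.2 ⟨Finset.mem_univ _, (Finset.mem_filter.1 ha).2⟩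
    · intro b hb
      by_cases hr : b ∈ Set.range e
      · obtain ⟨a, rfl⟩ := hr
        exact ⟨a, Finset.mem_filter.2 ⟨Finset.mem_univ _, (Finset.mem_filter.1 hb).2⟩, rfl⟩
      · exfalso
        simp [Matrix.vecMul, dotProduct, h0 b hr] at hb
  simp only [Encodes, key]

/-- The matrix whose columns are listed by `g`. -/
def matrixOf (k r : ℕ) (g : ℕ → ℕ) : Matrix (Fin k) (Fin r) (ZMod 2) :=
  fun i j => (g (j * k + i) : ZMod 2)

theorem hammingNorm_natCast {n : ℕ} (x : ℕ → ℕ) :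
    hammingNorm (fun i : Fin n => (x i : ZMod 2)) = ∑ i ∈ Finset.range n, x i % 2 := by
  rw [Finset.sum_range, hammingNorm, Finset.card_filter]
  refine Finset.sum_congr rfl fun i _ => ?_
  rcases Nat.mod_two_eq_zero_or_one (x i) with h | h
  · rw [h, if_neg]
    simpa [ZMod.natCast_eq_zero_iff] using h
  · rw [h, if_pos]
    rw [Ne, ZMod.natCast_eq_zero_iff]
    omega

theorem hammingNorm_vecMul_matrixOf {k r : ℕ} (x g : ℕ → ℕ) :
    hammingNorm (Matrix.vecMul (fun i : Fin k => (x i : ZMod 2)) (matrixOf k r g)) =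
      parityWeight k r x g := by
  have : Matrix.vecMul (fun i : Fin k => (x i : ZMod 2)) (matrixOf k r g) =
      fun j : Fin r => ((∑ i ∈ Finset.range k, x i * g (j * k + i) : ℕ) : ZMod 2) := by
    ext j
    simp [Matrix.vecMul, dotProduct, matrixOf, Finset.sum_range]
  rw [this, hammingNorm_natCast fun j => ∑ i ∈ Finset.range k, x i * g (j * k + i)]
  rfl

/-- This makes the enumerations exhaustive: every message and every matrix has a number. -/
theorem exists_bitAt (n : ℕ) (f : ℕ → ℕ) (hf : ∀ i, f i < 2) :
    ∃ N < 2 ^ n, ∀ i < n, bitAt N i = f i := by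
  refine ⟨Nat.ofBits fun i : Fin n => decide (f i = 1), Nat.ofBits_lt_two_pow _, fun i hi => ?_⟩
  have := hf i
  rw [bitAt, ← Nat.toNat_testBit, Nat.testBit_ofBits_lt _ _ hi]
  by_cases h : f i = 1
  · simp [h]
  · simp [h]; omega

/-- The numbers from 1 to `2 ^ k - 1` are the digit sequences of the non-zero messages. -/
theorem matrixOk_iff {k d r : ℕ} (g : ℕ → ℕ) : MatrixOk k d r g ↔ Encodes d (matrixOf k r g) := by
  have key : ∀ x, MessageOk k d r (bitAt x) g ↔
      0 < hammingNorm (Matrix.vecMul (fun i : Fin k => (bitAt x i : ZMod 2)) (matrixOf k r g)) ∧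
      d ≤ hammingNorm (fun i : Fin k => (bitAt x i : ZMod 2)) +
        hammingNorm (Matrix.vecMul (fun i : Fin k => (bitAt x i : ZMod 2)) (matrixOf k r g)) := by
    intro x
    rw [hammingNorm_vecMul_matrixOf, hammingNorm_natCast, MessageOk]
    simp only [Nat.mod_eq_of_lt (bitAt_lt _ _)]
  constructor
  · intro h x hx
    obtain ⟨N, hN, hb⟩ := exists_bitAt k (fun i => if h : i < k then (x ⟨i, h⟩).val else 0)
      (fun i => by split; exacts [ZMod.val_lt _, by norm_num])
    have hxN : x = fun i : Fin k => (bitAt N i : ZMod 2) := by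
      ext i
      rw [hb i i.2]
      simp
    have hN0 : N ≠ 0 := by
      rintro rfl
      exact hx (by rw [hxN]; ext i; simp [bitAt_zero])
    rw [hxN]
    exact (key N).1 (h N (by omega) hN)
  · intro h x hx1 hx2
    refine (key x).2 (h _ fun h0 => ?_)
    have h1 : ∀ i < k, bitAt x i = 0 := by
      intro i hi
      have := congrFun h0 ⟨i, hi⟩
      simp only [Pi.zero_apply, ZMod.natCast_eq_zero_iff] at this
      have h2 := bitAt_lt x i
      omega
    have : x = 0 := by
      apply Nat.eq_of_testBit_eq
      intro i
      rw [Nat.zero_testBit]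
      rcases lt_or_ge i k with hi | hi
      · have := h1 i hi
        rw [bitAt, ← Nat.toNat_testBit] at this
        simpa using this
      · exact Nat.testBit_lt_two_pow (hx2.trans_le (Nat.pow_le_pow_right (by norm_num) hi))
    omega

/-! ### Lower bound: the cost of a feasible circuit is at least that of its matrix -/

theorem Circuit.value_congr {I O V : Type} [Finite V] (H : Circuit I O V) {x x' : I → ZMod 2} (v : V)
    (h : ∀ i, Relation.ReflTransGen H.edge (H.inputVertex i) v → x i = x' i) :
    H.value x v = H.value x' v := by
  induction v using H.edge_wellFounded.induction with
  | _ v ih =>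
  have hs : (fun (u : V) (_ : H.edge u v) => H.value x u) =
      fun (u : V) (_ : H.edge u v) => H.value x' u :=
    funext fun u => funext fun hu => ih u hu fun i hi => h i (hi.tail hu)
  rw [H.value_eq, H.value_eq, hs]
  unfold Circuit.localValue
  split
  · rename_i i hi
    have : v = H.inputVertex i := (H.input_unique i).unique hi (H.input_unique i).choose_spec.1
    exact h i (this ▸ Relation.ReflTransGen.refl)
  all_goals rfl

/-- Without a path from `i` to `y`, the unit message at `i` and the zero message give the same
output at `y`, so the entry of `G` vanishes. -/
theorem Circuit.mem_support {k : ℕ} {O V : Type} [Finite V] (H : Circuit (Fin k) O V)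
    {G : Matrix (Fin k) O (ZMod 2)} (hG : ∀ x, H.eval x = Matrix.vecMul x G) {i : Fin k} {y : O}
    (hi : G i y ≠ 0) : i ∈ H.support y := by
  by_contra hn
  apply hi
  have h1 := congrFun (hG (Pi.single i 1)) y
  have h0 := congrFun (hG 0) y
  rw [Circuit.eval, H.value_congr (x' := 0) (H.outputVertex y)] at h1
  · rw [Circuit.eval, h1] at h0
    simpa using h0
  · intro j hj
    have : j ≠ i := by rintro rfl; exact hn hj
    simp [this]

theorem nonzeroColumns_length_le {k r m : ℕ} {g : ℕ → ℕ}
    (h : ∀ j < r, m ≤ j → ∀ i < k, g (j * k + i) = 0) : (nonzeroColumns k r g).length ≤ m := by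
  have hsub : nonzeroColumns k r g ⊆ List.range m := by
    intro j hj
    simp only [nonzeroColumns, List.mem_filter, List.mem_range, decide_eq_true_eq] at hj ⊢
    obtain ⟨hjr, i, hi, hgi⟩ := hj
    by_contra hm
    rw [h j hjr (by omega) i hi] at hgi
    omega
  have := ((List.nodup_range.filter _).subperm hsub).length_le
  rwa [List.length_range] at this

/-- The number of ones in a column. -/
theorem ncard_columnSupport {k : ℕ} (g : ℕ → ℕ) (hg : ∀ i, g i < 2) (j : ℕ) :
    (columnSupport k g j).ncard = ∑ i ∈ Finset.range k, g (j * k + i) := by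
  classical
  rw [columnSupport, Set.ncard_eq_toFinset_card', Set.toFinset_ofPred, Finset.card_filter,
    Finset.sum_range]
  refine Finset.sum_congr rfl fun i _ => ?_
  have := hg (j * k + i)
  split <;> omega

/-- `N` is the number of the circuit's matrix, padded with zero columns up to `r` and listed column
by column. The weight of each column is at most the size of the support of its output. -/
theorem exists_matrix_of_isFeasible {k d r m : ℕ} {V : Type} [Finite V] (hk : 1 ≤ k)
    (H : Circuit (Fin k) (Fin m) V) (hm : m ≤ r) (hH : IsFeasible d H) :
    ∃ N < 2 ^ (r * k), MatrixOk k d r (bitAt N) ∧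
      matrixWeight k r (bitAt N) ≤ H.individualInputs ∧
      (nonzeroColumns k r (bitAt N)).length ≤ m := by
  obtain ⟨⟨G, hG, hinj, hd⟩, -⟩ := hH
  obtain ⟨N, hN, hb⟩ := exists_bitAt (r * k)
    (fun q => if h : q / k < m then (G ⟨q % k, Nat.mod_lt _ hk⟩ ⟨q / k, h⟩).val else 0)
    (fun i => by split; exacts [ZMod.val_lt _, by norm_num])
  have hval : ∀ (i : Fin k) (j : ℕ) (hj : j < r), bitAt N (j * k + i) =
      if h : j < m then (G i ⟨j, h⟩).val else 0 := by
    intro i j hj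
    rw [hb _ (column_index_lt i.2 hj)]
    have h1 : (j * k + i) / k = j := by
      rw [mul_comm, Nat.mul_add_div hk, Nat.div_eq_of_lt i.2, add_zero]
    have h2 : (j * k + i) % k = i := by
      rw [mul_comm, Nat.mul_add_mod, Nat.mod_eq_of_lt i.2]
    simp only [h1, h2]
  refine ⟨N, hN, ?_, ?_, ?_⟩
  · rw [matrixOk_iff, ← encodes_submatrix_iff _ (Fin.castLE_injective hm)]
    · have : (matrixOf k r (bitAt N)).submatrix id (Fin.castLE hm) = G := by
        ext i j
        simp [matrixOf, hval i j (j.2.trans_le hm)]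
      rw [this]
      exact (encodes_iff hk G).2 ⟨hinj, hd⟩
    · intro j hj i
      have : ¬ (j : ℕ) < m := fun h => hj ⟨⟨j, h⟩, rfl⟩
      simp [matrixOf, hval i j j.2, this]
  · have h1 : matrixWeight k r (bitAt N) =
        ∑ j ∈ Finset.range m, ∑ i ∈ Finset.range k, bitAt N (j * k + i) := by
      rw [matrixWeight]
      refine (Finset.sum_subset (Finset.range_subset_range.2 hm) fun j hj hj' => ?_).symm
      refine Finset.sum_eq_zero fun i hi => ?_
      simp only [Finset.mem_range] at hi hj hj'
      rw [hval ⟨i, hi⟩ j hj, dif_neg hj']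
    rw [h1, Finset.sum_range, Circuit.individualInputs]
    refine Finset.sum_le_sum fun j _ => ?_
    rw [← ncard_columnSupport _ (bitAt_lt N)]
    refine Set.ncard_le_ncard (fun i hi => ?_) (Set.toFinite _)
    refine H.mem_support hG fun h0 => ?_
    have : bitAt N (j * k + i) = 1 := hi
    rw [hval i j (j.2.trans_le hm)] at this
    simp [h0] at this
  · refine nonzeroColumns_length_le fun j hj hmj i hi => ?_
    rw [hval ⟨i, hi⟩ j hj, dif_neg (by omega)]

/-! ### Upper bound: the constructed circuit is feasible and costs at most the matrix -/

theorem mem_nonzeroColumns {k r : ℕ} {g : ℕ → ℕ} {j : ℕ} :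
    j ∈ nonzeroColumns k r g ↔ j < r ∧ ∃ i < k, g (j * k + i) = 1 := by
  simp [nonzeroColumns]

/-- The position in the matrix of a non-zero column. -/
def columnIndex (k r : ℕ) (g : ℕ → ℕ) (y : Fin (nonzeroColumns k r g).length) : Fin r :=
  ⟨(nonzeroColumns k r g)[y], (mem_nonzeroColumns.1 (List.getElem_mem _)).1⟩

theorem columnIndex_injective (k r : ℕ) (g : ℕ → ℕ) : Function.Injective (columnIndex k r g) := by
  intro y z h
  have hn : (nonzeroColumns k r g).Nodup := List.nodup_range.filter _
  exact Fin.ext ((hn.getElem_inj_iff).1 (Fin.ext_iff.1 h))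

namespace Built

variable {k r : ℕ} {g : ℕ → ℕ} {L : List (Ann k)}
  (h : Built g (nonzeroColumns k r g) (nonzeroColumns k r g).length L)

theorem isFeasible_circuit {d : ℕ} (hk : 1 ≤ k) (hg : ∀ i, g i < 2) (hok : MatrixOk k d r g) :
    IsFeasible d h.circuit := by
  refine ⟨⟨(matrixOf k r g).submatrix id (columnIndex k r g), fun x => ?_, ?_⟩,
    h.independent_circuit⟩
  · ext y
    rw [h.eval_circuit]
    simp [columnSum, Matrix.vecMul, dotProduct, matrixOf, columnIndex]
  · rw [← encodes_iff hk, encodes_submatrix_iff _ (columnIndex_injective k r g), ← matrixOk_iff]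
    · exact hok
    · intro j hj i
      have : g (j * k + i) ≠ 1 := by
        intro h1
        obtain ⟨y, hy, hy'⟩ := List.mem_iff_getElem.1
          (mem_nonzeroColumns.2 ⟨j.2, (i : ℕ), i.2, h1⟩)
        exact hj ⟨⟨y, hy⟩, Fin.ext hy'⟩
      have h2 := hg (j * k + i)
      have h0 : g (j * k + i) = 0 := by omega
      simp [matrixOf, h0]

theorem individualInputs_circuit_le (hg : ∀ i, g i < 2) :
    h.circuit.individualInputs ≤ matrixWeight k r g := by
  let f : Fin r → ℕ := fun j => ∑ i ∈ Finset.range k, g (j * k + i)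
  calc h.circuit.individualInputs
      ≤ ∑ y, f (columnIndex k r g y) := by
        refine Finset.sum_le_sum fun y _ => ?_
        refine (Set.ncard_le_ncard (h.support_circuit_subset y) (Set.toFinite _)).trans ?_
        rw [ncard_columnSupport g hg]
        rfl
    _ = ∑ j ∈ Finset.univ.map ⟨_, columnIndex_injective k r g⟩, f j := by
        rw [Finset.sum_map]
        rfl
    _ ≤ ∑ j, f j := Finset.sum_le_sum_of_subset (Finset.subset_univ _)
    _ = matrixWeight k r g := by rw [matrixWeight, Finset.sum_range]

end Built

/-! ### The search -/

/-- Among the matrices with numbers below `N`, none is suitable (register 22 is 0), or the state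
holds the circuit of a suitable one of least cost, with the cost in the registers 21 and 23. -/
def Best (k d r N : ℕ) (s : State) : Prop :=
  (s.reg 22 = 0 ∧ s.reg 21 = k + r * k ∧ ∀ M < N, ¬ MatrixOk k d r (bitAt M)) ∨
  (s.reg 22 = 1 ∧ (∃ (B : ℕ) (L : List (Ann k)), MatrixOk k d r (bitAt B) ∧
      s.reg 21 = matrixWeight k r (bitAt B) ∧
      s.reg 23 = (nonzeroColumns k r (bitAt B)).length ∧
      Emitted s (k + r * k) (L.map Ann.desc) ∧ L.length ≤ k + r * (4 * k + 1) ∧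
      Built (bitAt B) (nonzeroColumns k r (bitAt B)) (nonzeroColumns k r (bitAt B)).length L) ∧
    ∀ M < N, MatrixOk k d r (bitAt M) → s.reg 21 < matrixWeight k r (bitAt M) ∨
      (s.reg 21 = matrixWeight k r (bitAt M) ∧
        s.reg 23 ≤ (nonzeroColumns k r (bitAt M)).length))

theorem Best.congr {k d r N : ℕ} {s s' : State} (h : Best k d r N s)
    (hr : ∀ a, 21 ≤ a → a ≤ 25 → s'.reg a = s.reg a)
    (hm : ∀ b, k + r * k ≤ b → s'.mem b = s.mem b) : Best k d r N s' := by
  have h21 := hr 21 (by norm_num) (by norm_num)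
  have h22 := hr 22 (by norm_num) (by norm_num)
  have h23 := hr 23 (by norm_num) (by norm_num)
  unfold Best
  rw [h21, h22, h23]
  refine h.imp id fun ⟨h1, ⟨B, L, h2, h3, h4, h5, h6⟩, h7⟩ => ⟨h1, ⟨B, L, h2, h3, h4, ?_, h6⟩, h7⟩
  exact h5.congr (hr 24 (by norm_num) (by norm_num)) (hr 25 (by norm_num) (by norm_num)) hm

theorem Best.succ {k d r N : ℕ} {s : State} (h : Best k d r N s)
    (hN : MatrixOk k d r (bitAt N) → s.reg 22 = 1 ∧ (s.reg 21 < matrixWeight k r (bitAt N) ∨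
      (s.reg 21 = matrixWeight k r (bitAt N) ∧
        s.reg 23 ≤ (nonzeroColumns k r (bitAt N)).length))) : Best k d r (N + 1) s := by
  refine h.imp (fun ⟨h1, h2, h3⟩ => ⟨h1, h2, fun M hM hok => ?_⟩)
    fun ⟨h1, h2, h3⟩ => ⟨h1, h2, fun M hM hok => ?_⟩
  · rcases Nat.lt_succ_iff_lt_or_eq.1 hM with hM | rfl
    · exact h3 M hM hok
    · have := (hN hok).1
      omega
  · rcases Nat.lt_succ_iff_lt_or_eq.1 hM with hM | rfl
    · exact h3 M hM hok
    · exact (hN hok).2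

/-- Records the matrix as the best one. -/
def update : Program := .instr (.copy 21 19) ;; .instr (.const 22 1) ;; emitMatrix

/-- The initial threshold `k + r * k` in register 21 exceeds every weight, so the first suitable
matrix is always recorded. -/
theorem matrixWeight_lt {k r : ℕ} {g : ℕ → ℕ} (hk : 1 ≤ k) (hg : ∀ i, g i < 2) :
    matrixWeight k r g < k + r * k := by
  have : matrixWeight k r g ≤ ∑ j ∈ Finset.range r, ∑ i ∈ Finset.range k, 1 :=
    Finset.sum_le_sum fun j _ => Finset.sum_le_sum fun i _ => Nat.le_of_lt_succ (hg _)
  simp at this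
  omega

/-- The circuit is written at once over the previous one, so the best matrix itself need not be kept
while the counter moves on. -/
theorem runs_update {s : State} {k d r N : ℕ} (h0 : s.reg 0 = k) (h2 : s.reg 2 = r)
    (h3 : s.reg 3 = k + r * k) (h5 : s.reg 5 = 1)
    (h19 : s.reg 19 = matrixWeight k r (bitAt N))
    (hm : ∀ q < r * k, s.mem (k + q) = bitAt N q) (hok : MatrixOk k d r (bitAt N))
    (hle : ∀ M < N, MatrixOk k d r (bitAt M) →
      matrixWeight k r (bitAt N) < matrixWeight k r (bitAt M) ∨
      (matrixWeight k r (bitAt N) = matrixWeight k r (bitAt M) ∧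
        (nonzeroColumns k r (bitAt N)).length ≤ (nonzeroColumns k r (bitAt M)).length)) :
    Runs update s (k * 10 + r * (k * 44 + 15) + 10) (fun s' =>
      Best k d r (N + 1) s' ∧ ∀ i < k + r * k, s'.mem i = s.mem i) := by
  refine Runs.mono (T := 1 + (1 + (k * 10 + r * (k * 44 + 15) + 8))) ?_ (by omega) (fun _ h => h)
  refine runs_seq <| runs_instr <| runs_seq <| runs_instr <|
    (runs_emitMatrix (k := k) (r := r) (g := bitAt N) (base := k + r * k) ?_ ?_ ?_ ?_ rfl ?_
      (bitAt_lt N)).conseq le_rfl fun s1 e1 r1 _ => ?_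
  · simpa [Instr.run] using h0
  · simpa [Instr.run] using h2
  · simpa [Instr.run] using h3
  · simpa [Instr.run] using h5
  · simpa [Instr.run] using hm
  obtain ⟨L, hE, hL, hm', h23, hB⟩ := e1
  have h21 : s1.reg 21 = matrixWeight k r (bitAt N) := by
    rw [r1 21 rfl]
    simpa [Instr.run] using h19
  refine ⟨Or.inr ⟨?_, ⟨N, L, hok, h21, h23, hE, hL, hB⟩, ?_⟩, hm'⟩
  · rw [r1 22 rfl]
    simp [Instr.run]
  · intro M hM hokM
    rw [h21, h23]
    rcases Nat.lt_succ_iff_lt_or_eq.1 hM with hM | rfl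
    · exact hle M hM hokM
    · exact Or.inr ⟨rfl, le_rfl⟩

/-- Records the matrix if it is suitable and better than the best one so far. -/
def consider : Program :=
  .branch (.eq 15 5)
    (matrixCost ;; .branch (.lt 19 21) update
      (.branch (.eq 19 21) (.branch (.lt 20 23) update skip) skip)) skip

open Classical in
-- Costs are compared lexicographically, first by weight and then by the number of non-zero columns.
-- A matrix that loses or ties leaves the record valid.
theorem runs_consider {s : State} {k d r N : ℕ} (hk : 1 ≤ k) (h0 : s.reg 0 = k) (h2 : s.reg 2 = r)
    (h3 : s.reg 3 = k + r * k) (h5 : s.reg 5 = 1)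
    (h15 : s.reg 15 = if MatrixOk k d r (bitAt N) then 1 else 0)
    (hm : ∀ q < r * k, s.mem (k + q) = bitAt N q) (hb : Best k d r N s) :
    Runs consider s (k * 10 + r * (k * 51 + 22) + 19) (fun s' =>
      Best k d r (N + 1) s' ∧ ∀ i < k + r * k, s'.mem i = s.mem i) := by
  refine Runs.mono (T := max ((r * (k * 7 + 7) + 5) +
    (max (k * 10 + r * (k * 44 + 15) + 10) (max (max (k * 10 + r * (k * 44 + 15) + 10) 1 + 1) 1 + 1)
      + 1)) 1 + 1) ?_ ?_ (fun _ h => h)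
  · refine runs_branch (fun h => ?_) (fun h => runs_instr ?_)
    · have hok : MatrixOk k d r (bitAt N) := by
        by_contra hn
        simp [Test.holds, h15, hn, h5] at h
      refine runs_seq <| (runs_matrixCost h0 h2 h5 hm (bitAt_lt N)).conseq le_rfl
        fun s1 e1 r1 m1 => ?_
      have hm1 := m1 rfl
      have hup := fun hle => (runs_update (s := s1) (k := k) (d := d) (r := r) (N := N)
        ((r1 0 rfl).trans h0) ((r1 2 rfl).trans h2) ((r1 3 rfl).trans h3) ((r1 5 rfl).trans h5)
        e1.1 (hm1 ▸ hm) hok hle).mono le_rfl fun s' h => (hm1 ▸ h)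
      have hb1 : Best k d r N s1 := by
        refine hb.congr (fun a h h' => ?_) fun b _ => by rw [hm1]
        interval_cases a <;> exact r1 _ rfl
      have hw := matrixWeight_lt (r := r) hk (bitAt_lt N)
      refine runs_branch (fun h' => hup fun M hM hokM => ?_)
        (fun h' => runs_branch
          (fun h'' => runs_branch (fun h3 => hup fun M hM hokM => ?_) (fun h3 => runs_instr ?_))
          (fun h'' => runs_instr ?_))
      · simp only [Test.holds, e1.1] at h'
        rcases hb1 with hc | hc
        · exact absurd hokM (hc.2.2 M hM)
        · rcases hc.2.2 M hM hokM with h4 | h4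
          · exact Or.inl (by omega)
          · exact Or.inl (by omega)
      · simp only [Test.holds, e1.1, e1.2] at h' h'' h3
        rcases hb1 with hc | hc
        · exact absurd hokM (hc.2.2 M hM)
        · rcases hc.2.2 M hM hokM with h4 | h4
          · exact Or.inl (by omega)
          · exact Or.inr (by omega)
      · simp only [Test.holds, e1.1, e1.2] at h' h'' h3
        refine ⟨Best.congr (s := s1) (hb1.succ fun _ => ⟨?_, Or.inr ⟨by omega, by omega⟩⟩)
          ?_ (fun _ _ => rfl), fun i _ => by simp [Instr.run, hm1]⟩
        · rcases hb1 with hc | hc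
          · omega
          · exact hc.1
        · intro a ha ha'
          have : a ≠ 6 := by omega
          simp [Instr.run, this]
      · simp only [Test.holds, e1.1] at h' h''
        refine ⟨Best.congr (s := s1) (hb1.succ fun _ => ⟨?_, Or.inl (by omega)⟩)
          ?_ (fun _ _ => rfl), fun i _ => by simp [Instr.run, hm1]⟩
        · rcases hb1 with hc | hc
          · omega
          · exact hc.1
        · intro a ha ha'
          have : a ≠ 6 := by omega
          simp [Instr.run, this]
    · have hok : ¬ MatrixOk k d r (bitAt N) := by
        intro hn
        simp [Test.holds, h15, hn, h5] at h
      refine ⟨Best.congr (s := s) (hb.succ fun h => absurd h hok) ?_ (fun _ _ => rfl),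
        fun _ _ => rfl⟩
      intro a ha ha'
      have : a ≠ 6 := by omega
      simp [Instr.run, this]
  · have : r * (k * 51 + 22) = r * (k * 7 + 7) + r * (k * 44 + 15) := by ring
    omega

/-- The search over all matrices. -/
def search : Program := .loop (.eq 16 4) (checkMatrix ;; consider ;; incMatrix)

/-- The bound for the number of steps of the search for each matrix. -/
def stepBound (k r : ℕ) : ℕ :=
  (k * 7 + 5 + (2 ^ k - 1) * (k * 12 + r * (k * 9 + 7) + 15)) +
    ((k * 10 + r * (k * 51 + 22) + 19) + (r * k * 7 + 3))

/-- The carry of the matrix counter becomes 1 exactly when all `2 ^ (r * k)` matrices have been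
considered. -/
theorem runs_search {s : State} {k d r : ℕ} (hk : 1 ≤ k) (h0 : s.reg 0 = k) (h1 : s.reg 1 = d)
    (h2 : s.reg 2 = r) (h3 : s.reg 3 = k + r * k) (h4 : s.reg 4 = 0) (h5 : s.reg 5 = 1)
    (h16 : s.reg 16 = 0) (h21 : s.reg 21 = k + r * k) (h22 : s.reg 22 = 0)
    (hm : ∀ b, s.mem b = 0) :
    Runs search s (2 ^ (r * k) * (stepBound k r + 1) + 1) (fun s' =>
      Best k d r (2 ^ (r * k)) s') := by
  classical
  refine (runs_loop (T := stepBound k r) (n := 2 ^ (r * k)) (fun N s' =>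
    Best k d r N s' ∧ (s'.reg 16 = if N = 2 ^ (r * k) then 1 else 0) ∧ (∀ i < k, s'.mem i = 0) ∧
    (∀ q < r * k, s'.mem (k + q) = bitAt N q) ∧
    ∀ a, search.writes a = false → s'.reg a = s.reg a) ⟨Or.inl ⟨h22, h21, by simp⟩, ?_, ?_, ?_,
      fun _ _ => rfl⟩ ?_ ?_).mono le_rfl fun s' h => h.1
  · rw [if_neg (by positivity), h16]
  · exact fun i _ => hm i
  · exact fun q _ => by rw [hm, bitAt_zero]
  · rintro N hN s0 ⟨hb, hc, hx, hg, hf⟩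
    have f0 := (hf 0 rfl).trans h0
    have f1 := (hf 1 rfl).trans h1
    have f2 := (hf 2 rfl).trans h2
    have f3 := (hf 3 rfl).trans h3
    have f4 := (hf 4 rfl).trans h4
    have f5 := (hf 5 rfl).trans h5
    refine ⟨by simp [Test.holds, hc, hN.ne, f4], ?_⟩
    refine runs_seq <| (runs_checkMatrix f0 f1 f2 f4 f5 hk hx hg (bitAt_lt N)).conseq le_rfl
      fun s1 e1 r1 _ => runs_seq <| (runs_consider (d := d) (N := N) hk ((r1 0 rfl).trans f0)
        ((r1 2 rfl).trans f2) ((r1 3 rfl).trans f3) ((r1 5 rfl).trans f5) e1.1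
        (fun q hq => by rw [e1.2.2 _ (by omega), hg q hq]) ?_).conseq le_rfl
      fun s2 e2 r2 _ => (runs_incMatrix (k := k) (n := r * k) (N := N)
        ((r2 0 rfl).trans ((r1 0 rfl).trans f0)) ((r2 3 rfl).trans ((r1 3 rfl).trans f3))
        ((r2 4 rfl).trans ((r1 4 rfl).trans f4)) ((r2 5 rfl).trans ((r1 5 rfl).trans f5))
        (fun q hq => by rw [e2.2 _ (by omega), e1.2.2 _ (by omega), hg q hq])).conseq le_rfl
      fun s3 e3 r3 _ => ⟨?_, ?_, fun i hi => ?_, e3.2.1, fun a ha => ?_⟩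
    · refine hb.congr (fun a ha ha' => ?_) fun b hb => e1.2.2 b (by omega)
      interval_cases a <;> exact r1 _ rfl
    · refine e2.1.congr (fun a ha ha' => ?_) fun b hb => e3.2.2 b (Or.inr hb)
      interval_cases a <;> exact r3 _ rfl
    · simp only [e3.1, two_pow_dvd_succ_iff hN]
    · rw [e3.2.2 i (Or.inl hi), e2.2 i (by omega), e1.2.1 i hi]
    · have ha' := ha
      simp only [search, Program.writes, Bool.or_eq_false_iff] at ha'
      rw [r3 a ha'.2.2, r2 a ha'.2.1, r1 a ha'.1, hf a ha]
  · rintro s' ⟨-, hc, -, -, hf⟩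
    simp [Test.holds, hc, hf 4 rfl, h4]

/-! ### The complete program -/

/-- Computes the constants and addresses. -/
def setup : Program :=
  .instr (.const 5 1) ;; .instr (.copy 3 0) ;; .instr (.const 8 0) ;;
  loopUp 8 2 (.instr (.const 7 0) ;; loopUp 7 0 (.instr (.inc 3))) ;; .instr (.copy 21 3)

theorem runs_setup {s : State} {k r : ℕ} (h0 : s.reg 0 = k) (h2 : s.reg 2 = r) :
    Runs setup s (r * (k * 3 + 4) + 5) (fun s' =>
      s'.reg 3 = k + r * k ∧ s'.reg 5 = 1 ∧ s'.reg 21 = k + r * k) := by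
  refine Runs.mono (T := 1 + (1 + (1 + (r * (1 + (k * 3 + 1) + 2) + 1 + 1)))) ?_ (by
    rw [show 1 + (k * 3 + 1) + 2 = k * 3 + 4 by ring]; omega) (fun _ h => h)
  refine runs_seq <| runs_instr <| runs_seq <| runs_instr <| runs_seq <| runs_instr <| runs_seq <|
    (runs_loopUp (a := 0) (n := r) (T := 1 + (k * 3 + 1)) (fun j s' => s'.reg 3 = k + j * k)
      rfl rfl (by decide) (by simp [Instr.run]) (by simpa [Instr.run] using h2)
      (by simp [Instr.run, h0]) ?_).conseq le_rfl fun s1 e1 r1 _ => runs_instr ?_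
  · rintro j hj s' h3 hi hf -
    have h0' : s'.reg 0 = k := (hf 0 rfl).trans (by simpa [Instr.run] using h0)
    refine runs_seq <| runs_instr <| (runs_loopUp (a := 0) (n := k) (T := 1)
      (fun i s' => s'.reg 3 = k + j * k + i) rfl rfl (by decide) (by simp [Instr.run])
      (by simpa [Instr.run] using h0') (by simp [Instr.run, h3]) ?_).mono le_rfl fun s'' h => ?_
    · rintro i hi' s2 h - - -
      refine runs_instr ?_
      simp [Instr.run, h, add_assoc]
    · simp [Instr.run, h]
      ring
  · simp [Instr.run, e1, r1 5 rfl]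

/-- The program that solves all instances. -/
def solver : Program :=
  .branch (.lt 2 0) (.instr (.const 0 0))
    (setup ;; search ;; .instr (.copy 0 22) ;; .instr (.copy 1 23) ;; .instr (.copy 2 24))

theorem runs_solver {k d r : ℕ} (hk : 1 ≤ k) (hr : k ≤ r) :
    Runs solver (initialState k d r)
      ((r * (k * 3 + 4) + 5) + ((2 ^ (r * k) * (stepBound k r + 1) + 1) + 3) + 1) (fun s' =>
      ∃ s, Best k d r (2 ^ (r * k)) s ∧ s'.reg 0 = s.reg 22 ∧ s'.reg 1 = s.reg 23 ∧
        s'.reg 2 = s.reg 24 ∧ s'.reg 3 = k + r * k ∧ s'.mem = s.mem) := by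
  refine (runs_branch (T := 0) (fun h => ?_) (fun _ => ?_)).mono
    (by rw [Nat.zero_max]) (fun _ h => h)
  · simp [Test.holds, initialState] at h
    omega
  · refine runs_seq <| (runs_setup (k := k) (r := r) rfl rfl).conseq le_rfl fun s1 e1 r1 m1 => ?_
    refine runs_seq <| (runs_search (d := d) hk (r1 0 rfl) (r1 1 rfl) (r1 2 rfl) e1.1 (r1 4 rfl)
      e1.2.1 (r1 16 rfl) e1.2.2 (r1 22 rfl) (fun b => by rw [m1 rfl]; rfl)).conseq le_rfl
      fun s2 e2 r2 _ => ?_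
    refine runs_seq (T := 1) (T' := 2) <| runs_instr <| runs_seq (T := 1) (T' := 1) <|
      runs_instr <| runs_instr ⟨s2, e2, ?_⟩
    simp [Instr.run, r2 3 rfl, e1.1]

/-! ### Estimates and conclusion -/

theorem stepBound_le {k r : ℕ} (hk : 1 ≤ k) (hr : k ≤ r) :
    (r * (k * 3 + 4) + 5) + ((2 ^ (r * k) * (stepBound k r + 1) + 1) + 3) + 1 ≤
      300 * (r * k * 2 ^ k * 2 ^ (r * k)) := by
  have h1 : 1 ≤ r * k := Nat.mul_pos (by omega) hk
  have h2 : k ≤ r * k := Nat.le_mul_of_pos_left _ (by omega)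
  have h3 : r ≤ r * k := Nat.le_mul_of_pos_right _ hk
  have hP : 1 ≤ 2 ^ k := Nat.one_le_two_pow
  have hQ : 1 ≤ 2 ^ (r * k) := Nat.one_le_two_pow
  have e1 : r * (k * 9 + 7) = 9 * (r * k) + 7 * r := by ring
  have e2 : r * (k * 51 + 22) = 51 * (r * k) + 22 * r := by ring
  have e3 : r * (k * 3 + 4) = 3 * (r * k) + 4 * r := by ring
  rw [stepBound, e1, e2, e3]
  -- With the powers and `r * k` as atoms, everything below follows from `k ≤ a`, `r ≤ a` and `1 ≤
  -- a, P, Q`.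
  generalize 2 ^ (r * k) = Q at *
  generalize 2 ^ k = P at *
  generalize r * k = a at *
  have hS : (k * 7 + 5 + (P - 1) * (k * 12 + (9 * a + 7 * r) + 15)) +
      ((k * 10 + (51 * a + 22 * r) + 19) + (a * 7 + 3)) + 1 ≤ 250 * (a * P) := by
    have q1 : (P - 1) * (k * 12 + (9 * a + 7 * r) + 15) ≤ P * (50 * a) :=
      Nat.mul_le_mul (by omega) (by omega)
    have q2 : a ≤ a * P := Nat.le_mul_of_pos_right _ hP
    have q3 : P * (50 * a) = 50 * (a * P) := by ring
    omega
  have hS' := Nat.mul_le_mul_left Q hS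
  have q4 : Q * (250 * (a * P)) = 250 * (a * P * Q) := by ring
  have q5 : a ≤ a * P * Q :=
    (Nat.le_mul_of_pos_right _ hP).trans (Nat.le_mul_of_pos_right _ hQ)
  omega

/-- The factor 2 is needed only for `k = 3`; the induction starts there. -/
theorem sq_le_two_pow (k : ℕ) : k ^ 2 ≤ 2 * 2 ^ k := by
  rcases lt_or_ge k 3 with h | h
  · interval_cases k <;> norm_num
  · induction k, h using Nat.le_induction with
    | base => norm_num
    | succ n hn ih => rw [pow_succ 2 n]; nlinarith

/-- An injection between the spaces of words forces `2 ^ k ≤ 2 ^ m`. This justifies the immediate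
negative answer for `r < k`. -/
theorem IsFeasible.le {k m d : ℕ} {V : Type} [Finite V] {H : Circuit (Fin k) (Fin m) V}
    (h : IsFeasible d H) : k ≤ m := by
  obtain ⟨⟨G, -, hinj, -⟩, -⟩ := h
  have := Fintype.card_le_of_injective _ hinj
  exact (Nat.pow_le_pow_iff_right (a := 2) (by norm_num)).1
    (by simpa [ZMod.card] using this)

/-- A competing circuit costs at least as much as its matrix, which the search has compared with the
recorded matrix, which in turn costs at least as much as the reported circuit. -/
theorem Best.reports {k d r : ℕ} {s s' : State} (hk : 1 ≤ k)
    (hb : Best k d r (2 ^ (r * k)) s) (h0 : s'.reg 0 = s.reg 22) (h1 : s'.reg 1 = s.reg 23)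
    (h2 : s'.reg 2 = s.reg 24) (h3 : s'.reg 3 = k + r * k) (hm : s'.mem = s.mem) :
    (∃ (m n : ℕ) (H : Circuit (Fin k) (Fin m) (Fin n)), Reports s' H ∧ IsOptimalSolution d r H ∧
      n ≤ k + r * (4 * k + 1) ∧ H.LongestPathLE (3 * k)) ∨
    (ReportsNone s' ∧ ¬ ∃ (m n : ℕ) (H : Circuit (Fin k) (Fin m) (Fin n)),
      m ≤ r ∧ IsFeasible d H) := by
  rcases hb with ⟨hb, -, hno⟩ | ⟨hb, ⟨B, L, hok, hw, hc, hE, hL, hB⟩, hmin⟩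
  · refine Or.inr ⟨h0.trans hb, ?_⟩
    rintro ⟨m, n, H, hmr, hH⟩
    obtain ⟨N, hN, hok, -⟩ := exists_matrix_of_isFeasible hk H hmr hH
    exact hno N hN hok
  · refine Or.inl ⟨_, _, hB.circuit, ⟨h0.trans hb, h1.trans hc, ?_, fun v => ?_⟩,
      ⟨nonzeroColumns_length_le (fun j hj hj' => absurd hj (by omega)),
        hB.isFeasible_circuit hk (bitAt_lt B) hok, ?_⟩, hL, hB.longestPath_circuit⟩
    · rw [h2, hE.length_eq, List.length_map]
    · refine hB.describesVertex_circuit v ?_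
      rw [h3, hm]
      exact hE.encodes v _ (by simp)
    · intro m' W _ H' hm' hH'
      obtain ⟨N, hN, hokN, hwN, hcN⟩ := exists_matrix_of_isFeasible hk H' hm' hH'
      have hle := hB.individualInputs_circuit_le (bitAt_lt B)
      have := hmin N hN hokN
      rw [hw, hc] at this
      omega

/-- After multiplication by `k`, the factor `k * k` is absorbed into `r * 2 ^ k`. -/
theorem time_le {k r : ℕ} (hk : 1 ≤ k) (hr : k ≤ r) :
    ((r * k * 2 ^ k * 2 ^ (r * k) : ℕ) : ℝ) ≤ (r : ℝ) ^ 2 / k * 2 ^ (r * k + 2 * k) := by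
  have hk0 : (0 : ℝ) < k := by exact_mod_cast hk
  have h : k * k ≤ r * 2 ^ k := Nat.mul_le_mul hr Nat.lt_two_pow_self.le
  have h' : (k : ℝ) * k ≤ r * 2 ^ k := by exact_mod_cast h
  rw [div_mul_eq_mul_div, le_div_iff₀ hk0]
  push_cast
  calc (r : ℝ) * k * 2 ^ k * 2 ^ (r * k) * k = (r * 2 ^ k * 2 ^ (r * k)) * (k * k) := by ring
    _ ≤ (r * 2 ^ k * 2 ^ (r * k)) * (r * 2 ^ k) := by gcongr
    _ = (r : ℝ) ^ 2 * 2 ^ (r * k + 2 * k) := by rw [pow_add, two_mul, pow_add]; ring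

theorem size_le {k r : ℕ} (hk : 1 ≤ k) (hr : k ≤ r) :
    ((k + r * (4 * k + 1) : ℕ) : ℝ) ≤ 12 * ((r : ℝ) / k * 2 ^ k) := by
  have hk0 : (0 : ℝ) < k := by exact_mod_cast hk
  have h : (k + r * (4 * k + 1)) * k ≤ 12 * (r * 2 ^ k) := by
    have h1 : k + r * (4 * k + 1) ≤ 6 * (r * k) := by nlinarith
    calc (k + r * (4 * k + 1)) * k ≤ 6 * (r * k) * k := Nat.mul_le_mul_right _ h1
      _ = 6 * r * k ^ 2 := by ring
      _ ≤ 6 * r * (2 * 2 ^ k) := Nat.mul_le_mul_left _ (sq_le_two_pow k)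
      _ = 12 * (r * 2 ^ k) := by ring
  rw [div_mul_eq_mul_div, mul_div_assoc', le_div_iff₀ hk0]
  exact_mod_cast h

/-- This lets the constant absorb the two steps of the immediate answer. -/
theorem one_le_bound {k r : ℕ} (hk : 1 ≤ k) (hr : 1 ≤ r) :
    (1 : ℝ) ≤ (r : ℝ) ^ 2 / k * 2 ^ (r * k + 2 * k) := by
  have hk0 : (0 : ℝ) < k := by exact_mod_cast hk
  have h : k ≤ r ^ 2 * 2 ^ (r * k + 2 * k) :=
    calc k ≤ 2 ^ k := Nat.lt_two_pow_self.le
      _ ≤ 2 ^ (r * k + 2 * k) := Nat.pow_le_pow_right (by norm_num) (by omega)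
      _ ≤ r ^ 2 * 2 ^ (r * k + 2 * k) := Nat.le_mul_of_pos_left _ (by positivity)
  rw [div_mul_eq_mul_div, le_div_iff₀ hk0, one_mul]
  exact_mod_cast h

end OptiCC

theorem mainTheorem5 :
    ∃ (P : OptiCC.Program) (C : ℝ), ∀ k d r : ℕ, 1 ≤ k → 1 ≤ r →
      ∃ (t : ℕ) (s : OptiCC.State),
        OptiCC.Exec P (OptiCC.initialState k d r) t s ∧
        (t : ℝ) ≤ C * ((r : ℝ) ^ 2 / (k : ℝ) * 2 ^ (r * k + 2 * k)) ∧
        ((∃ (m n : ℕ) (H : OptiCC.Circuit (Fin k) (Fin m) (Fin n)),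
            OptiCC.Reports s H ∧
            OptiCC.IsOptimalSolution d r H ∧
            (H.gates.ncard : ℝ) ≤ C * ((r : ℝ) / (k : ℝ) * 2 ^ k) ∧
            H.LongestPathLE (C * (k : ℝ))) ∨
          (OptiCC.ReportsNone s ∧
            ¬ ∃ (m n : ℕ) (H : OptiCC.Circuit (Fin k) (Fin m) (Fin n)),
              m ≤ r ∧ OptiCC.IsFeasible d H)) := by
  -- One constant serves all three bounds: the time needs 300, the number of gates only 12 and the
  -- paths only 3.
  refine ⟨OptiCC.solver, 300, fun k d r hk hr => ?_⟩
  rcases lt_or_ge r k with hrk | hrk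
  · refine ⟨1 + 1, _, .branch_true (by simpa [OptiCC.Test.holds, OptiCC.initialState] using hrk)
      (.instr _ _), ?_, Or.inr ⟨by simp [OptiCC.ReportsNone, OptiCC.Instr.run], ?_⟩⟩
    · have := OptiCC.one_le_bound hk hr
      push_cast
      linarith
    · rintro ⟨m, n, H, hm, hH⟩
      have := hH.le
      omega
  · obtain ⟨t, s', he, ht, s, hb, h0, h1, h2, h3, hm⟩ := OptiCC.runs_solver (d := d) hk hrk
    refine ⟨t, s', he, ?_, (hb.reports hk h0 h1 h2 h3 hm).imp ?_ id⟩
    · have h4 : (t : ℝ) ≤ (300 * (r * k * 2 ^ k * 2 ^ (r * k)) : ℕ) := by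
        exact_mod_cast ht.trans (OptiCC.stepBound_le hk hrk)
      have h5 := OptiCC.time_le hk hrk
      rw [Nat.cast_mul] at h4
      norm_num only [Nat.cast_ofNat] at h4
      linarith
    · rintro ⟨m, n, H, hrep, hopt, hn, hpath⟩
      refine ⟨m, n, H, hrep, hopt, ?_, fun p hp => (hpath p hp).trans ?_⟩
      · have h4 : H.gates.ncard ≤ k + r * (4 * k + 1) := by
          refine (Set.ncard_le_card H.gates).trans ?_
          simpa using hn
        have h5 := OptiCC.size_le hk hrk
        have h6 : (H.gates.ncard : ℝ) ≤ ((k + r * (4 * k + 1) : ℕ) : ℝ) := by exact_mod_cast h4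
        have h7 : (0 : ℝ) ≤ (r : ℝ) / k * 2 ^ k := by positivity
        linarith
      · have : (0 : ℝ) ≤ k := Nat.cast_nonneg k
        linarith
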